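/- Let $w\ge 1$, let $(V_i)_{i\ge 1}=((\tilde X_i,\tilde Y_i))_{i\ge1}$ be a sequence of random variables with values in $\mathbb R^w\times\mathbb R$, let $F(\cdot\mid x)$ be the distribution function of a regular version of the conditional law of $\tilde Y_1$ given $\tilde X_1=x$, and fix $\tilde x\in\mathbb R^w$. Assume the following, for some $\delta>0$. 1. (Mixing) $(V_i)$ is strictly stationary and strongly mixing with $\alpha(\tau)=\mathcal O(\tau^{-(2+\delta)})$, where $$\alpha(\tau)=\sup_{m\ge1}\ \sup\{|\mathbb P(A\cap B)-\mathbb P(A)\mathbb P(B)|:\ A\in\sigma(V_i,\,i\le m),\ B\in\sigma(V_i,\,i\ge m+\tau)\}.$$ 2. (Smoothness) For every $y\in\mathbb R$, $0<F(y\mid\tilde x)<1$ and $x\mapsto F(y\mid x)$ is twice continuously differentiable at $\tilde x$ (that is, in a neighbourhood of $\tilde x$). The law of $\tilde X_1$ has a Lebesgue density $g$ with $g(\tilde x)>0$ and $g$ continuous at $\tilde x$. There are $M>0$ and $i_0$ such that for all $i\ge i_0$ the pair $(\tilde X_1,\tilde X_i)$ has a density $g_{1,i}$ with $|g_{1,i}(u,v)-g(u)g(v)|\le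 M$ for all $u,v$. 3. (Kernel) $K:\mathbb R^w\to\mathbb R$ is nonnegative, bounded, continuous and compactly supported, with $\int K=1$, $\int uK(u)\,du=0$, $\int uu^\top K(u)\,du=\mu_2I$, $\int K^2=\nu_0$ and $\int uu^\top K^2(u)\,du=\nu_2I$ for some $\mu_2,\nu_0,\nu_2\in(0,\infty)$. 4. (Bandwidth) $h=h_n>0$, $h\to0$ and $nh^{w(1+2/\delta)}\to\infty$ as $n\to\infty$. Put $K_h(u)=h^{-w}K(h^{-1}u)$. Let $(p_i)_{i=1}^n$ maximize $\sum_{i=1}^n\log p_i$ (with $\log 0=-\infty$) subject to $p_i\ge0$, $\sum_ip_i=1$ and $\sum_ip_i(\tilde X_i-\tilde x)K_h(\tilde X_i-\tilde x)=0$; for samples that admit no maximizer of finite log-likelihood, set $p_i=1/n$ by convention. The reweighted Nadaraya–Watson estimator is $$\widehat F(b\mid\tilde x)=\frac{\sum_{i=1}^np_iK_h(\tilde X_i-\tilde x)\,\mathbf 1(\tilde Y_i\le b)}{\sum_{i=1}^np_iK_h(\tilde X_i-\tilde x)},$$ (with the value $0$ if the denominator vanishes). For $\beta\in(0,1)$ put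 $\widehat Q_\beta(\tilde x)=\inf\{y\in\mathbb R:\widehat F(y\mid\tilde x)\ge\beta\}$ (with the value $0$ if this set is empty) and $Q_\beta(\tilde x)=\inf\{y\in\mathbb R:F(y\mid\tilde x)\ge\beta\}$. Then for every $\beta\in(0,1)$ for which the conditional $\beta$-quantile is unique, i.e. $F(y\mid\tilde x)>\beta$ for all $y>Q_\beta(\tilde x)$, $$\widehat Q_\beta(\tilde x)\to Q_\beta(\tilde x)\quad\text{in probability as }n\to\infty .$$ -/

import Mathlib

open MeasureTheory ProbabilityTheory Filter Topology Asymptotics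
open scoped ENNReal

namespace RNW

/-! ### Strict stationarity and strong mixing -/

section TimeSeries

variable {Ω S : Type*} [MeasurableSpace Ω] [MeasurableSpace S]

/-- Strict stationarity: the law of the whole path is invariant under time shifts. -/
def IsStationary (V : ℕ → Ω → S) (μ : Measure Ω) : Prop :=
  ∀ k : ℕ, μ.map (fun ω (i : ℕ) => V (i + k) ω) = μ.map (fun ω (i : ℕ) => V i ω)

/-- The σ-algebra generated by `V 0, …, V m`. -/
abbrev pastSigma (V : ℕ → Ω → S) (m : ℕ) : MeasurableSpace Ω :=
  ⨆ i : ℕ, ⨆ _ : i ≤ m, MeasurableSpace.comap (V i) inferInstance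

/-- The σ-algebra generated by `V m, V (m+1), …`. -/
abbrev futureSigma (V : ℕ → Ω → S) (m : ℕ) : MeasurableSpace Ω :=
  ⨆ i : ℕ, ⨆ _ : m ≤ i, MeasurableSpace.comap (V i) inferInstance

/-- The strong mixing coefficient `α(τ)`: the supremum of `|ℙ(A ∩ B) - ℙ(A) ℙ(B)|` over all events
`A` of the past up to some time `m` and all events `B` of the future from time `m + τ` on.
(For a stationary process this is the coefficient of its two-sided extension.) -/
noncomputable def mixingCoeff (V : ℕ → Ω → S) (μ : Measure Ω) (τ : ℕ) : ℝ :=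
  sSup {r : ℝ | ∃ (m : ℕ) (A B : Set Ω), MeasurableSet[pastSigma V m] A ∧
    MeasurableSet[futureSigma V (m + τ)] B ∧ r = |μ.real (A ∩ B) - μ.real A * μ.real B|}

/-- Stationarity, together with `α(τ) = O(τ ^ (-(2 + δ)))` as `τ → ∞`. -/
structure MixingAssumption (V : ℕ → Ω → S) (μ : Measure Ω) (δ : ℝ) : Prop where
  stationary : IsStationary V μ
  mixing : (fun τ : ℕ => mixingCoeff V μ τ) =O[atTop] fun τ : ℕ => (τ : ℝ) ^ (-(2 + δ))

end TimeSeries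

/-! ### The conditional distribution function, its quantiles, and the smoothness assumption -/

/-- The conditional distribution function `F(b | x)` belonging to a conditional law `κ`. -/
noncomputable def condCDF {E : Type*} [MeasurableSpace E] (κ : Kernel E ℝ) (b : ℝ) (x : E) : ℝ :=
  (κ x).real (Set.Iic b)

/-- The generalized inverse `inf {y | β ≤ G y}`. -/
noncomputable def quantile (G : ℝ → ℝ) (β : ℝ) : ℝ :=
  sInf {y : ℝ | β ≤ G y}

/-- `f` is a (version of the) density of `ν` with respect to Lebesgue measure. -/
structure IsDensity {E : Type*} [MeasureSpace E] (ν : Measure E) (f : E → ℝ) : Prop where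
  measurable : Measurable f
  nonneg : ∀ x, 0 ≤ f x
  eq_withDensity : ν = volume.withDensity fun x => ENNReal.ofReal (f x)

/-- Smoothness of the conditional distribution function and of the densities at the point `x`.
Here `κ` is the conditional law of the response given the predictor, `g` is the density of the
predictor, and time starts at `0`.  The bound on the joint densities is required for all
sufficiently large lags. -/
structure SmoothnessAssumption {Ω : Type*} [MeasurableSpace Ω] {w : ℕ} (μ : Measure Ω)
    (X : ℕ → Ω → EuclideanSpace ℝ (Fin w)) (κ : Kernel (EuclideanSpace ℝ (Fin w)) ℝ)
    (g : EuclideanSpace ℝ (Fin w) → ℝ) (x : EuclideanSpace ℝ (Fin w)) : Prop where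
  cdf_pos : ∀ y : ℝ, 0 < condCDF κ y x
  cdf_lt_one : ∀ y : ℝ, condCDF κ y x < 1
  cdf_smooth : ∀ y : ℝ, ContDiffAt ℝ 2 (condCDF κ y) x
  density_pos : 0 < g x
  density_continuousAt : ContinuousAt g x
  joint_density : ∃ M : ℝ, 0 < M ∧ ∃ i₀ : ℕ, ∀ i : ℕ, i₀ ≤ i →
    ∃ g₂ : EuclideanSpace ℝ (Fin w) × EuclideanSpace ℝ (Fin w) → ℝ,
      IsDensity (μ.map fun ω => (X 0 ω, X i ω)) g₂ ∧ ∀ u v, |g₂ (u, v) - g u * g v| ≤ M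

/-! ### Kernel function and bandwidth -/

/-- Regularity of the smoothing kernel `K`. -/
structure KernelAssumption {w : ℕ} (K : EuclideanSpace ℝ (Fin w) → ℝ) : Prop where
  nonneg : ∀ u, 0 ≤ K u
  bounded : ∃ C : ℝ, ∀ u, K u ≤ C
  continuous : Continuous K
  compactSupport : HasCompactSupport K
  integral_eq_one : ∫ u, K u = 1
  first_moment : ∫ u, K u • u = 0
  second_moment : ∃ μ₂ : ℝ, 0 < μ₂ ∧
    ∀ j k : Fin w, ∫ u, u j * u k * K u = if j = k then μ₂ else 0
  sq_integral : ∃ ν₀ : ℝ, 0 < ν₀ ∧ ∫ u, K u ^ 2 = ν₀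
  sq_second_moment : ∃ ν₂ : ℝ, 0 < ν₂ ∧
    ∀ j k : Fin w, ∫ u, u j * u k * K u ^ 2 = if j = k then ν₂ else 0

/-- Bandwidths `h n > 0` with `h n → 0` and `n * h n ^ (w (1 + 2 / δ)) → ∞`. -/
structure BandwidthAssumption (w : ℕ) (δ : ℝ) (h : ℕ → ℝ) : Prop where
  pos : ∀ n, 0 < h n
  tendsto_zero : Tendsto h atTop (𝓝 0)
  tendsto_atTop : Tendsto (fun n : ℕ => (n : ℝ) * h n ^ ((w : ℝ) * (1 + 2 / δ))) atTop atTop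

/-! ### The reweighted Nadaraya–Watson estimator -/

section Estimator

variable {w n : ℕ}

/-- The rescaled kernel `K_h(u) = h⁻ʷ K(h⁻¹ u)`. -/
noncomputable def scaledKernel (K : EuclideanSpace ℝ (Fin w) → ℝ) (h : ℝ)
    (u : EuclideanSpace ℝ (Fin w)) : ℝ :=
  (h ^ w)⁻¹ * K (h⁻¹ • u)

/-- The constraints on the adjustment weights at `x`.  Weights are taken positive, since a vector
with a zero entry has log-likelihood `-∞`. -/
structure IsFeasible (K : EuclideanSpace ℝ (Fin w) → ℝ) (h : ℝ)
    (X : Fin n → EuclideanSpace ℝ (Fin w)) (x : EuclideanSpace ℝ (Fin w))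
    (p : Fin n → ℝ) : Prop where
  pos : ∀ i, 0 < p i
  sum_eq_one : ∑ i, p i = 1
  moment : ∑ i, (p i * scaledKernel K h (X i - x)) • (X i - x) = 0

/-- `p` maximizes the empirical log-likelihood `∑ log p i` under the constraints. -/
structure IsAdjustment (K : EuclideanSpace ℝ (Fin w) → ℝ) (h : ℝ)
    (X : Fin n → EuclideanSpace ℝ (Fin w)) (x : EuclideanSpace ℝ (Fin w))
    (p : Fin n → ℝ) : Prop where
  feasible : IsFeasible K h X x p
  maximal : ∀ q : Fin n → ℝ, IsFeasible K h X x q →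
    ∑ i, Real.log (q i) ≤ ∑ i, Real.log (p i)

open Classical in
/-- The adjustment weights: the maximizer (unique, by strict concavity) if there is one.  By
convention the weights are `1 / n` for samples for which the constraints cannot be met. -/
noncomputable def adjustmentWeights (K : EuclideanSpace ℝ (Fin w) → ℝ) (h : ℝ)
    (X : Fin n → EuclideanSpace ℝ (Fin w)) (x : EuclideanSpace ℝ (Fin w)) : Fin n → ℝ :=
  if hp : ∃ p : Fin n → ℝ, IsAdjustment K h X x p then hp.choose else fun _ => 1 / (n : ℝ)

/-- The final weights `Ŵᵢ(x)`. -/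
noncomputable def finalWeights (K : EuclideanSpace ℝ (Fin w) → ℝ) (h : ℝ)
    (X : Fin n → EuclideanSpace ℝ (Fin w)) (x : EuclideanSpace ℝ (Fin w)) (i : Fin n) : ℝ :=
  adjustmentWeights K h X x i * scaledKernel K h (X i - x) /
    ∑ j, adjustmentWeights K h X x j * scaledKernel K h (X j - x)

/-- The estimated conditional distribution function `F̂(b | x)`. -/
noncomputable def estCDF (K : EuclideanSpace ℝ (Fin w) → ℝ) (h : ℝ)
    (X : Fin n → EuclideanSpace ℝ (Fin w)) (Y : Fin n → ℝ)
    (x : EuclideanSpace ℝ (Fin w)) (b : ℝ) : ℝ :=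
  ∑ i, finalWeights K h X x i * (Set.Iic b).indicator (fun _ => (1 : ℝ)) (Y i)

/-- The estimated conditional quantile `Q̂_β(x)`. -/
noncomputable def estQuantile (K : EuclideanSpace ℝ (Fin w) → ℝ) (h : ℝ)
    (X : Fin n → EuclideanSpace ℝ (Fin w)) (Y : Fin n → ℝ)
    (x : EuclideanSpace ℝ (Fin w)) (β : ℝ) : ℝ :=
  quantile (estCDF K h X Y x) β

end Estimator

end RNW

/-! The empirical-likelihood weights are a small perturbation of `1/n`, so the estimator behaves
like an ordinary ratio of kernel averages, and monotonicity in the response turns pointwise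
consistency of the distribution function into consistency of the quantile.

Law of large numbers (`tendstoInMeasure_localAverage`). For a bounded, compactly supported `φ`, the
averages `(n h^w)⁻¹ ∑ φ((X i - x)/h) 1(Y i ∈ S)` have convergent means by a change of variables and
dominated convergence. Their variance is `O(1/(n h^w))`: at lag `τ` the covariance is at most of
order `h^(2w)` by the joint density bound, and at most of order `τ^(-(2+δ))` by mixing. The
geometric mean of the two is `h^w τ^(-(1+δ/2))`, which is summable in `τ`
(`exists_summable_covariance_bound`).

Weights. Put `U i = (X i - x)/h` and `W i = K(U i) U i`. A zero `l` of `∑ W i / (1 + ⟪l, W i⟫)` with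
positive denominators yields the maximizer `n p i = 1/(1 + ⟪l, W i⟫)`
(`adjustmentWeights_eq_of_multiplier`). Such an `l` is a critical point of `D l = ∑ log(1 + ⟪l, W
i⟫)`. By the law of large numbers the normalized linear part of `D` tends to `0`, while its
quadratic part is governed by `ν₂ g(x) I`. So with high probability `D < 0 = D 0` on a sphere of any
prescribed small radius, and `D` has a critical point inside (`exists_multiplier`). As `W` is
bounded, `n p i` is then uniformly close to `1`.

Conclusion. The estimated distribution function is thus below `β` at `Q - ε` and above `β` at `Q +
ε` with high probability, which traps its generalized inverse. -/

namespace RNW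

/-! ### Covariance inequality under strong mixing, and consequences of stationarity. -/

section Covariance

variable {Ω S : Type*} [MeasurableSpace Ω] [MeasurableSpace S]

/-- Layer-cake formula: both integrals are integrals over levels `t ∈ (0, C]` of the measure of `{t
≤ f}`. The two measures need not be probabilities, which allows the restricted, scaled and weighted
measures used below. -/
lemma abs_integral_sub_le_of_superlevel {ν₁ ν₂ : Measure Ω} [IsFiniteMeasure ν₁]
    [IsFiniteMeasure ν₂] {f : Ω → ℝ} (hf : Measurable f) {C a : ℝ} (hC : 0 ≤ C)
    (h0 : ∀ ω, 0 ≤ f ω) (hfC : ∀ ω, f ω ≤ C)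
    (h : ∀ t, |ν₁.real {ω | t ≤ f ω} - ν₂.real {ω | t ≤ f ω}| ≤ a) :
    |∫ ω, f ω ∂ν₁ - ∫ ω, f ω ∂ν₂| ≤ C * a := by
  have hint : ∀ ν : Measure Ω, IsFiniteMeasure ν → Integrable f ν := fun ν _ =>
    Integrable.of_bound hf.aestronglyMeasurable C
      (ae_of_all _ fun ω => by rw [Real.norm_of_nonneg (h0 ω)]; exact hfC ω)
  have hlevel : ∀ ν : Measure Ω, IsFiniteMeasure ν →
      IntegrableOn (fun t => ν.real {ω | t ≤ f ω}) (Set.Ioc 0 C) := by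
    intro ν _
    have hanti : Antitone fun t => ν.real {ω | t ≤ f ω} := fun s t hst =>
      measureReal_mono fun ω (hω : t ≤ f ω) => hst.trans hω
    exact ((hanti.antitoneOn _).integrableOn_isCompact isCompact_Icc).mono_set
      Set.Ioc_subset_Icc_self
  rw [(hint ν₁ inferInstance).integral_eq_integral_Ioc_meas_le (ae_of_all _ h0) (ae_of_all _ hfC),
    (hint ν₂ inferInstance).integral_eq_integral_Ioc_meas_le (ae_of_all _ h0) (ae_of_all _ hfC),
    ← integral_sub (hlevel ν₁ inferInstance) (hlevel ν₂ inferInstance), ← Real.norm_eq_abs]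
  refine (norm_setIntegral_le_of_norm_le_const (C := a) (by simp) fun t _ => h t).trans ?_
  simp [hC, mul_comm]

lemma abs_integral_mul_sub_le {μ : Measure Ω} [IsProbabilityMeasure μ] {ξ η : Ω → ℝ}
    (hξ : Measurable ξ) (hη : Measurable η) {C a : ℝ} (hC : 0 ≤ C)
    (hξ0 : ∀ ω, 0 ≤ ξ ω) (hξC : ∀ ω, ξ ω ≤ C) (hη0 : ∀ ω, 0 ≤ η ω) (hηC : ∀ ω, η ω ≤ C)
    (h : ∀ s t, |μ.real ({ω | s ≤ ξ ω} ∩ {ω | t ≤ η ω})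
      - μ.real {ω | s ≤ ξ ω} * μ.real {ω | t ≤ η ω}| ≤ a) :
    |∫ ω, ξ ω * η ω ∂μ - (∫ ω, ξ ω ∂μ) * ∫ ω, η ω ∂μ| ≤ C * (C * a) := by
  have hint : Integrable ξ μ := Integrable.of_bound hξ.aestronglyMeasurable C
      (ae_of_all _ fun ω => by rw [Real.norm_of_nonneg (hξ0 ω)]; exact hξC ω)
  have hset : ∀ t, |∫ ω in {ω | t ≤ η ω}, ξ ω ∂μ - μ.real {ω | t ≤ η ω} * ∫ ω, ξ ω ∂μ| ≤ C * a := by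
    intro t
    have hB : MeasurableSet {ω | t ≤ η ω} := measurableSet_le measurable_const hη
    -- Layer cake in `ξ` with the event `{t ≤ η}` fixed: restricting `μ` to the event is compared
    -- with scaling `μ` by its probability.
    have key := abs_integral_sub_le_of_superlevel (ν₁ := μ.restrict {ω | t ≤ η ω})
      (ν₂ := (μ {ω | t ≤ η ω}).toNNReal • μ) hξ (a := a) hC hξ0 hξC (fun s => ?_)
    · rwa [integral_smul_nnreal_measure] at key
    · have := h s t
      rw [measureReal_restrict_apply (measurableSet_le measurable_const hξ),
        measureReal_nnreal_smul_apply]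
      rw [mul_comm] at this
      exact this
  have hfin : ∫⁻ ω, ENNReal.ofReal (ξ ω) ∂μ ≠ ∞ := hint.lintegral_lt_top.ne
  have : IsFiniteMeasure (μ.withDensity fun ω => ENNReal.ofReal (ξ ω)) :=
    isFiniteMeasure_withDensity hfin
  -- Layer cake in `η`: the measure with density `ξ` is compared with `μ` scaled by the mean of `ξ`.
  -- The previous step bounds the discrepancy on superlevel sets of `η`.
  have key := abs_integral_sub_le_of_superlevel
    (ν₁ := μ.withDensity fun ω => ENNReal.ofReal (ξ ω))
    (ν₂ := (∫ ω, ξ ω ∂μ).toNNReal • μ) hη (a := C * a) hC hη0 hηC (fun t => ?_)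
  · rw [integral_smul_nnreal_measure, integral_withDensity_eq_integral_toReal_smul
      hξ.ennreal_ofReal (ae_of_all _ fun ω => by simp)] at key
    simp only [ENNReal.toReal_ofReal (hξ0 _), smul_eq_mul, NNReal.smul_def,
      Real.coe_toNNReal _ (integral_nonneg hξ0)] at key
    exact key
  · have := hset t
    have hB : MeasurableSet {ω | t ≤ η ω} := measurableSet_le measurable_const hη
    rw [measureReal_nnreal_smul_apply, Real.coe_toNNReal _ (integral_nonneg hξ0),
      measureReal_def, withDensity_apply _ hB,
      ← integral_eq_lintegral_of_nonneg_ae (ae_of_all _ hξ0) hξ.aestronglyMeasurable]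
    rwa [mul_comm] at this

lemma memLp_two_of_abs_le {μ : Measure Ω} [IsFiniteMeasure μ] {ξ : Ω → ℝ} (hξ : Measurable ξ)
    {C : ℝ} (hC : ∀ ω, |ξ ω| ≤ C) : MemLp ξ 2 μ :=
  MemLp.of_bound hξ.aestronglyMeasurable C (ae_of_all _ hC)

/-- The covariance inequality for bounded random variables. -/
lemma abs_covariance_le_of_superlevel {μ : Measure Ω} [IsProbabilityMeasure μ] {ξ η : Ω → ℝ}
    (hξ : Measurable ξ) (hη : Measurable η) {C a : ℝ} (hξC : ∀ ω, |ξ ω| ≤ C)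
    (hηC : ∀ ω, |η ω| ≤ C)
    (h : ∀ s t, |μ.real ({ω | s ≤ ξ ω} ∩ {ω | t ≤ η ω})
      - μ.real {ω | s ≤ ξ ω} * μ.real {ω | t ≤ η ω}| ≤ a) :
    |cov[ξ, η; μ]| ≤ 4 * C ^ 2 * a := by
  have hC : 0 ≤ C := by
    obtain ⟨ω⟩ := nonempty_of_isProbabilityMeasure μ
    exact (abs_nonneg _).trans (hξC ω)
  have hξL := memLp_two_of_abs_le (μ := μ) hξ hξC
  have hηL := memLp_two_of_abs_le (μ := μ) hη hηC
  have hle : ∀ ζ : Ω → ℝ, (∀ ω, |ζ ω| ≤ C) → ∀ ω, 0 ≤ ζ ω + C ∧ ζ ω + C ≤ 2 * C :=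
    fun ζ hζ ω => by have := abs_le.1 (hζ ω); constructor <;> linarith
  -- Shifting by `C` leaves the covariance unchanged and moves the values into `[0, 2C]`, whence the
  -- factor `4 = 2²`.
  have key := abs_integral_mul_sub_le (μ := μ) (hξ.add_const C) (hη.add_const C) (C := 2 * C)
    (a := a) (by positivity) (fun ω => (hle ξ hξC ω).1) (fun ω => (hle ξ hξC ω).2)
    (fun ω => (hle η hηC ω).1) (fun ω => (hle η hηC ω).2) (fun s t => by
      simpa only [sub_le_iff_le_add] using h (s - C) (t - C))
  rw [← covariance_add_const_left (hξL.integrable one_le_two) C,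
    ← covariance_add_const_right (hηL.integrable one_le_two) C,
    covariance_eq_sub (X := fun ω => ξ ω + C) (Y := fun ω => η ω + C)
      (hξL.add (memLp_const C)) (hηL.add (memLp_const C))]
  calc _ ≤ 2 * C * (2 * C * a) := key
    _ = 4 * C ^ 2 * a := by ring

lemma abs_real_inter_sub_mul_le_one (μ : Measure Ω) [IsProbabilityMeasure μ] (A B : Set Ω) :
    |μ.real (A ∩ B) - μ.real A * μ.real B| ≤ 1 := by
  have h1 : μ.real (A ∩ B) ≤ 1 := measureReal_le_one
  have h2 : μ.real A * μ.real B ≤ 1 := mul_le_one₀ measureReal_le_one measureReal_nonneg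
    measureReal_le_one
  have h3 : 0 ≤ μ.real (A ∩ B) := measureReal_nonneg
  have h4 : 0 ≤ μ.real A * μ.real B := by positivity
  rw [abs_le]; constructor <;> linarith

lemma le_mixingCoeff (V : ℕ → Ω → S) (μ : Measure Ω) [IsProbabilityMeasure μ] {m τ : ℕ}
    {A B : Set Ω} (hA : MeasurableSet[pastSigma V m] A)
    (hB : MeasurableSet[futureSigma V (m + τ)] B) :
    |μ.real (A ∩ B) - μ.real A * μ.real B| ≤ mixingCoeff V μ τ := by
  -- The real supremum dominates its elements only for a set bounded above; `1` is a bound.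
  refine le_csSup ⟨1, ?_⟩ ⟨m, A, B, hA, hB, rfl⟩
  rintro r ⟨m, A, B, -, -, rfl⟩
  exact abs_real_inter_sub_mul_le_one μ A B

lemma mixingCoeff_nonneg (V : ℕ → Ω → S) (μ : Measure Ω) [IsProbabilityMeasure μ] (τ : ℕ) :
    0 ≤ mixingCoeff V μ τ :=
  (abs_nonneg _).trans (le_mixingCoeff V μ (m := 0) (A := ∅) (B := ∅)
    (@MeasurableSet.empty _ (pastSigma V 0)) (@MeasurableSet.empty _ (futureSigma V (0 + τ))))

lemma abs_covariance_le_mixingCoeff {V : ℕ → Ω → S} (hV : ∀ i, Measurable (V i)) (μ : Measure Ω)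
    [IsProbabilityMeasure μ] {f : S → ℝ} (hf : Measurable f) {C : ℝ} (hC : ∀ s, |f s| ≤ C)
    (i τ : ℕ) :
    |cov[fun ω => f (V i ω), fun ω => f (V (i + τ) ω); μ]| ≤ 4 * C ^ 2 * mixingCoeff V μ τ := by
  refine abs_covariance_le_of_superlevel (hf.comp (hV i)) (hf.comp (hV (i + τ)))
    (fun ω => hC _) (fun ω => hC _) fun s t => le_mixingCoeff V μ (m := i) ?_ ?_
  · have hle : MeasurableSpace.comap (V i) inferInstance ≤ pastSigma V i :=
      le_iSup₂_of_le i le_rfl le_rfl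
    exact hle _ ⟨{v | s ≤ f v}, measurableSet_le measurable_const hf, rfl⟩
  · have hle : MeasurableSpace.comap (V (i + τ)) inferInstance ≤ futureSigma V (i + τ) :=
      le_iSup₂_of_le (i + τ) le_rfl le_rfl
    exact hle _ ⟨{v | t ≤ f v}, measurableSet_le measurable_const hf, rfl⟩

lemma IsStationary.map_pair {V : ℕ → Ω → S} {μ : Measure Ω} (hV : ∀ i, Measurable (V i))
    (h : IsStationary V μ) (k i j : ℕ) :
    μ.map (fun ω => (V (i + k) ω, V (j + k) ω)) = μ.map (fun ω => (V i ω, V j ω)) := by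
  have hT : Measurable fun v : ℕ → S => (v i, v j) := by fun_prop
  have h1 := congrArg (Measure.map fun v : ℕ → S => (v i, v j)) (h k)
  rwa [Measure.map_map hT (measurable_pi_lambda _ fun i => hV (i + k)),
    Measure.map_map hT (measurable_pi_lambda _ hV)] at h1

lemma IsStationary.map_eq {V : ℕ → Ω → S} {μ : Measure Ω} (hV : ∀ i, Measurable (V i))
    (h : IsStationary V μ) (k : ℕ) : μ.map (V k) = μ.map (V 0) := by
  have h1 := congrArg (Measure.map Prod.fst) (h.map_pair hV k 0 0)
  rw [Measure.map_map measurable_fst (by fun_prop), Measure.map_map measurable_fst (by fun_prop)]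
    at h1
  simpa [Function.comp_def] using h1

end Covariance

/-! ### Variance of a sum with summable covariance bounds. -/

section Variance

variable {Ω : Type*} [MeasurableSpace Ω]

/-- For fixed `i` the lags `j - i` are distinct integers, so each of the `n` rows is at most the
full series. -/
lemma sum_sum_int_sub_le {b : ℤ → ℝ} (hb : Summable b) (hb0 : ∀ k, 0 ≤ b k) (n : ℕ) :
    ∑ i : Fin n, ∑ j : Fin n, b ((j : ℤ) - i) ≤ n * ∑' k, b k := by
  have : ∀ i : Fin n, ∑ j : Fin n, b ((j : ℤ) - i) ≤ ∑' k, b k := by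
    intro i
    have hinj : Function.Injective fun j : Fin n => ((j : ℤ) - i) := fun j k hjk => by
      simpa [Fin.ext_iff] using hjk
    have hsum := Finset.sum_map Finset.univ ⟨_, hinj⟩ b
    exact hsum.symm.trans_le (hb.sum_le_tsum _ fun k _ => hb0 k)
  calc _ ≤ ∑ _i : Fin n, ∑' k, b k := Finset.sum_le_sum fun i _ => this i
    _ = _ := by simp

lemma variance_sum_le {μ : Measure Ω} [IsProbabilityMeasure μ] {n : ℕ} {ξ : Fin n → Ω → ℝ}
    (hξ : ∀ i, MemLp (ξ i) 2 μ) {b : ℤ → ℝ} (hb : Summable b) (hb0 : ∀ k, 0 ≤ b k) {p : ℝ}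
    (hcov : ∀ i j, |cov[ξ i, ξ j; μ]| ≤ p * b ((j : ℤ) - i)) (hp : 0 ≤ p) :
    Var[fun ω => ∑ i, ξ i ω; μ] ≤ p * (n * ∑' k, b k) := by
  rw [variance_fun_sum hξ]
  calc _ ≤ ∑ i : Fin n, ∑ j : Fin n, p * b ((j : ℤ) - i) :=
        Finset.sum_le_sum fun i _ => Finset.sum_le_sum fun j _ => (le_abs_self _).trans (hcov i j)
    _ = p * ∑ i : Fin n, ∑ j : Fin n, b ((j : ℤ) - i) := by simp_rw [Finset.mul_sum]
    _ ≤ _ := by gcongr; exact sum_sum_int_sub_le hb hb0 n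

end Variance

/-! ### Small-ball probabilities, covariances of localized variables, and Chebyshev. -/

section LocalAverage

variable {Ω : Type*} [MeasurableSpace Ω]

lemma IsDensity.real_le {E : Type*} [MeasureSpace E] {ν : Measure E} {f : E → ℝ}
    (hf : IsDensity ν f) {B : Set E} (hB : MeasurableSet B) (hfin : volume B ≠ ∞) {c : ℝ}
    (hc : 0 ≤ c) (hle : ∀ u ∈ B, f u ≤ c) : ν.real B ≤ c * volume.real B := by
  have h1 : ν B ≤ ENNReal.ofReal c * volume B := by
    rw [hf.eq_withDensity, withDensity_apply _ hB, ← setLIntegral_const]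
    exact setLIntegral_mono measurable_const fun u hu => ENNReal.ofReal_le_ofReal (hle u hu)
  have h2 := ENNReal.toReal_mono (ENNReal.mul_ne_top ENNReal.ofReal_ne_top hfin) h1
  rwa [ENNReal.toReal_mul, ENNReal.toReal_ofReal hc] at h2

/-- Near `x` the density is at most `g x + 1`, so on the product of two small balls the joint
density is bounded too; the ball has volume of order `h ^ w`. -/
lemma exists_ball_bounds {w : ℕ} {μ : Measure Ω} [IsProbabilityMeasure μ]
    {X : ℕ → Ω → EuclideanSpace ℝ (Fin w)} (hX : ∀ i, Measurable (X i))
    {κ : Kernel (EuclideanSpace ℝ (Fin w)) ℝ} {g : EuclideanSpace ℝ (Fin w) → ℝ}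
    (hg : IsDensity (μ.map (X 0)) g) {x : EuclideanSpace ℝ (Fin w)}
    (hsmooth : SmoothnessAssumption μ X κ g x) {R : ℝ} (hR : 0 ≤ R) :
    ∃ D : ℝ, 0 ≤ D ∧ ∃ i₀ : ℕ, ∀ᶠ h in 𝓝[>] (0 : ℝ),
      μ.real {ω | X 0 ω ∈ Metric.closedBall x (h * R)} ≤ D * h ^ w ∧
      ∀ i, i₀ ≤ i → μ.real ({ω | X 0 ω ∈ Metric.closedBall x (h * R)} ∩
        {ω | X i ω ∈ Metric.closedBall x (h * R)}) ≤ D * (h ^ w) ^ 2 := by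
  obtain ⟨M, hM, i₀, hj⟩ := hsmooth.joint_density
  set c := g x + 1 with hc
  have hc0 : 0 < c := by have := hsmooth.density_pos; linarith
  set q := R ^ w * volume.real (Metric.ball (0 : EuclideanSpace ℝ (Fin w)) 1) with hq
  have hq0 : 0 ≤ q := by positivity
  -- The sum of the constants for one and for two visits, so that a single `D` serves both bounds.
  refine ⟨c * q + (c * c + M) * q ^ 2, by positivity, i₀, ?_⟩
  have hnear : ∀ᶠ u in 𝓝 x, g u ≤ c :=
    (hsmooth.density_continuousAt.eventually (gt_mem_nhds (lt_add_one (g x)))).mono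
      fun u hu => hu.le
  obtain ⟨r, hr, hball⟩ := Metric.eventually_nhds_iff.1 hnear
  have hsmall : ∀ᶠ h in 𝓝[>] (0 : ℝ), h * R < r := by
    have : Tendsto (fun h : ℝ => h * R) (𝓝[>] 0) (𝓝 (0 * R)) :=
      ((continuous_id.mul continuous_const).tendsto 0).mono_left nhdsWithin_le_nhds
    exact this.eventually (gt_mem_nhds (by simpa using hr))
  filter_upwards [hsmall, self_mem_nhdsWithin] with h hhr (hh : 0 < h)
  set B := Metric.closedBall x (h * R) with hBdef
  have hB : MeasurableSet B := Metric.isClosed_closedBall.measurableSet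
  have hvolB : volume.real B = h ^ w * q := by
    rw [hBdef, Measure.addHaar_real_closedBall _ _ (by positivity), finrank_euclideanSpace_fin,
      mul_pow, hq, mul_assoc]
  have hBfin : volume B ≠ ∞ := (isCompact_closedBall x _).measure_ne_top
  have hgB : ∀ u ∈ B, g u ≤ c := fun u hu => hball (lt_of_le_of_lt hu hhr)
  have hp : 0 ≤ h ^ w := by positivity
  constructor
  · have h1 := hg.real_le hB hBfin hc0.le hgB
    rw [map_measureReal_apply (hX 0) hB, hvolB] at h1
    calc _ ≤ c * (h ^ w * q) := h1
      _ = c * q * h ^ w := by ring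
      _ ≤ _ := by
        gcongr
        exact le_add_of_nonneg_right (by positivity)
  · intro i hi
    obtain ⟨g₂, hg₂, hle⟩ := hj i hi
    have h1 := hg₂.real_le (B := B ×ˢ B) (hB.prod hB)
      (by rw [Measure.volume_eq_prod, Measure.prod_prod]; exact ENNReal.mul_ne_top hBfin hBfin)
      (c := c * c + M) (by positivity) (by
        rintro ⟨u, v⟩ ⟨hu, hv⟩
        have h2 := (abs_le.1 (hle u v)).2
        have h3 : g u * g v ≤ c * c :=
          mul_le_mul (hgB u hu) (hgB v hv) (hg.nonneg v) hc0.le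
        linarith)
    rw [map_measureReal_apply ((hX 0).prodMk (hX i)) (hB.prod hB), Measure.volume_eq_prod,
      measureReal_prod_prod, hvolB] at h1
    calc _ ≤ (c * c + M) * (h ^ w * q * (h ^ w * q)) := h1
      _ = (c * c + M) * q ^ 2 * (h ^ w) ^ 2 := by ring
      _ ≤ _ := by
        gcongr
        exact le_add_of_nonneg_left (by positivity)

/-- Covariance bound for bounded random variables supported on given events. -/
lemma abs_covariance_le_of_support {μ : Measure Ω} [IsProbabilityMeasure μ] {ξ η : Ω → ℝ}
    (hξ : Measurable ξ) (hη : Measurable η) {C : ℝ} {A B : Set Ω} (hA : MeasurableSet A)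
    (hB : MeasurableSet B) (hC : 0 ≤ C) (hξC : ∀ ω, |ξ ω| ≤ C) (hηC : ∀ ω, |η ω| ≤ C)
    (hξA : ∀ ω, ω ∉ A → ξ ω = 0) (hηB : ∀ ω, ω ∉ B → η ω = 0) :
    |cov[ξ, η; μ]| ≤ C ^ 2 * (μ.real (A ∩ B) + μ.real A * μ.real B) := by
  have key : ∀ (ζ : Ω → ℝ) (S : Set Ω) (c : ℝ), MeasurableSet S → (∀ ω, |ζ ω| ≤ c) →
      (∀ ω, ω ∉ S → ζ ω = 0) → |∫ ω, ζ ω ∂μ| ≤ c * μ.real S := by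
    intro ζ S c hS hc h0
    rw [← setIntegral_eq_integral_of_forall_compl_eq_zero h0, ← Real.norm_eq_abs]
    exact norm_setIntegral_le_of_norm_le_const (measure_lt_top _ _) fun ω _ => hc ω
  rw [covariance_eq_sub (memLp_two_of_abs_le hξ hξC) (memLp_two_of_abs_le hη hηC)]
  have h1 := key (ξ * η) (A ∩ B) (C ^ 2) (hA.inter hB)
    (fun ω => by
      rw [Pi.mul_apply, abs_mul, sq]
      exact mul_le_mul (hξC ω) (hηC ω) (abs_nonneg _) hC)
    (fun ω hω => by
      rw [Pi.mul_apply]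
      by_cases hωA : ω ∈ A
      · rw [hηB ω fun hωB => hω ⟨hωA, hωB⟩, mul_zero]
      · rw [hξA ω hωA, zero_mul])
  have h2 : |(∫ ω, ξ ω ∂μ) * ∫ ω, η ω ∂μ| ≤ C * μ.real A * (C * μ.real B) := by
    rw [abs_mul]
    exact mul_le_mul (key ξ A C hA hξC hξA) (key η B C hB hηC hηB) (abs_nonneg _) (by positivity)
  calc _ ≤ _ := abs_sub _ _
    _ ≤ C ^ 2 * μ.real (A ∩ B) + C * μ.real A * (C * μ.real B) := add_le_add h1 h2
    _ = _ := by ring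

/-- Chebyshev at level `ε / 2`, the other half of `ε` absorbing the bias. -/
lemma tendstoInMeasure_of_variance {μ : Measure Ω} [IsProbabilityMeasure μ] {Z : ℕ → Ω → ℝ}
    (hZ : ∀ n, MemLp (Z n) 2 μ) {L : ℝ} (hmean : Tendsto (fun n => ∫ ω, Z n ω ∂μ) atTop (𝓝 L))
    (hvar : Tendsto (fun n => Var[Z n; μ]) atTop (𝓝 0)) :
    TendstoInMeasure μ Z atTop fun _ => L := by
  rw [tendstoInMeasure_iff_norm]
  intro ε hε
  have hlim : Tendsto (fun n => ENNReal.ofReal (Var[Z n; μ] / (ε / 2) ^ 2)) atTop (𝓝 0) := by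
    have := ENNReal.tendsto_ofReal (hvar.div_const ((ε / 2) ^ 2))
    simpa using this
  refine tendsto_of_tendsto_of_tendsto_of_le_of_le' tendsto_const_nhds hlim
    (Eventually.of_forall fun _ => zero_le) ?_
  filter_upwards [Metric.tendsto_nhds.1 hmean (ε / 2) (by positivity)] with n hn
  refine (measure_mono fun ω hω => ?_).trans
    (meas_ge_le_variance_div_sq (hZ n) (c := ε / 2) (by positivity))
  simp only [Set.mem_ofPred_eq, Real.norm_eq_abs] at hω ⊢
  rw [Real.dist_eq] at hn
  have := abs_sub_le (Z n ω) (∫ ω, Z n ω ∂μ) L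
  linarith

end LocalAverage

/-! ### Law of large numbers for localized averages. -/

section LocalTerm

variable {Ω : Type*} [MeasurableSpace Ω] {w : ℕ}

/-- A summand of a localized average: `φ` localizes the predictor, `S` is an event for the
response. -/
noncomputable def localTerm (φ : EuclideanSpace ℝ (Fin w) → ℝ) (S : Set ℝ)
    (x : EuclideanSpace ℝ (Fin w)) (h : ℝ) (v : EuclideanSpace ℝ (Fin w) × ℝ) : ℝ :=
  φ (h⁻¹ • (v.1 - x)) * S.indicator (fun _ => (1 : ℝ)) v.2

variable {φ : EuclideanSpace ℝ (Fin w) → ℝ} {S : Set ℝ} {x : EuclideanSpace ℝ (Fin w)}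

lemma measurable_localTerm (hφ : Measurable φ) (hS : MeasurableSet S) (h : ℝ) :
    Measurable (localTerm φ S x h) := by
  unfold localTerm
  exact (hφ.comp (by fun_prop)).mul ((measurable_const.indicator hS).comp measurable_snd)

lemma abs_localTerm_le {C : ℝ} (hC : ∀ u, |φ u| ≤ C) (h : ℝ)
    (v : EuclideanSpace ℝ (Fin w) × ℝ) : |localTerm φ S x h v| ≤ C := by
  unfold localTerm
  by_cases hv : v.2 ∈ S
  · simpa [hv] using hC _
  · simpa [hv] using (abs_nonneg _).trans (hC 0)

lemma localTerm_eq_zero {R : ℝ} (hR : ∀ u, R < ‖u‖ → φ u = 0) {h : ℝ} (hh : 0 < h)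
    {v : EuclideanSpace ℝ (Fin w) × ℝ} (hv : v.1 ∉ Metric.closedBall x (h * R)) :
    localTerm φ S x h v = 0 := by
  unfold localTerm
  rw [hR, zero_mul]
  rw [Metric.mem_closedBall, dist_eq_norm, not_le] at hv
  rw [norm_smul, norm_inv, Real.norm_of_nonneg hh.le, lt_inv_mul_iff₀ hh]
  exact hv

/-- The factor `h ^ w`, one power of the small-ball probability, must survive while the lags remain
summable. Mixing alone loses the former and the density bound alone loses the latter; their
geometric mean keeps both. -/
lemma exists_summable_covariance_bound {μ : Measure Ω} [IsProbabilityMeasure μ]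
    {X : ℕ → Ω → EuclideanSpace ℝ (Fin w)} {Y : ℕ → Ω → ℝ} (hX : ∀ i, Measurable (X i))
    (hY : ∀ i, Measurable (Y i)) {δ : ℝ} (hδ : 0 < δ)
    (hmix : MixingAssumption (fun i ω => (X i ω, Y i ω)) μ δ)
    {κ : Kernel (EuclideanSpace ℝ (Fin w)) ℝ} {g : EuclideanSpace ℝ (Fin w) → ℝ}
    (hg : IsDensity (μ.map (X 0)) g) (hsmooth : SmoothnessAssumption μ X κ g x)
    (hφ : Measurable φ) {C R : ℝ} (hC : ∀ u, |φ u| ≤ C) (hR0 : 0 ≤ R)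
    (hR : ∀ u, R < ‖u‖ → φ u = 0) (hS : MeasurableSet S) :
    ∃ b : ℤ → ℝ, Summable b ∧ (∀ k, 0 ≤ b k) ∧ ∀ᶠ h in 𝓝[>] (0 : ℝ), ∀ i j : ℕ,
      |cov[fun ω => localTerm φ S x h (X i ω, Y i ω),
        fun ω => localTerm φ S x h (X j ω, Y j ω); μ]| ≤ h ^ w * b ((j : ℤ) - i) := by
  obtain ⟨D, hD, i₀, hball⟩ := exists_ball_bounds hX hg hsmooth hR0
  obtain ⟨A, hA, hmixA⟩ := hmix.mixing.exists_pos
  obtain ⟨i₁, hi₁⟩ := eventually_atTop.1 (isBigOWith_iff.1 hmixA)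
  have hC0 : 0 ≤ C := (abs_nonneg _).trans (hC 0)
  set N := max i₀ i₁ with hN
  set G := C ^ 2 * (2 * D + D ^ 2) with hG
  set H := G * (4 * C ^ 2 * A) with hH
  have hV : ∀ i, Measurable fun ω => (X i ω, Y i ω) := fun i => (hX i).prodMk (hY i)
  -- Lags below `N`, where the joint density or mixing bound may be unavailable, get the constant
  -- `G`; the others get the square root of the mixing rate.
  set b : ℤ → ℝ := fun k => G * (if k.natAbs < N then 1 else 0)
    + √H * |(k : ℝ)| ^ (-(1 + δ / 2)) with hb
  have hG0 : 0 ≤ G := by positivity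
  refine ⟨b, ?_, ?_, ?_⟩
  · refine Summable.add (Summable.mul_left _ ?_)
      ((Real.summable_abs_int_rpow (by linarith)).mul_left _)
    refine summable_of_ne_finset_zero (s := Finset.Icc (-(N : ℤ)) N) fun k hk => ?_
    rw [if_neg]
    rw [Finset.mem_Icc] at hk
    omega
  · intro k
    simp only [hb]
    split_ifs <;> positivity
  have hpow : ∀ᶠ h in 𝓝[>] (0 : ℝ), h ≤ 1 :=
    (eventually_le_nhds one_pos).filter_mono nhdsWithin_le_nhds
  filter_upwards [hball, hpow, self_mem_nhdsWithin] with h ⟨hb1, hb2⟩ hh1 (hh : 0 < h)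
  set p := h ^ w with hp
  have hp0 : 0 < p := by positivity
  set B := Metric.closedBall x (h * R) with hBdef
  have hB : MeasurableSet B := Metric.isClosed_closedBall.measurableSet
  have hf := measurable_localTerm (x := x) hφ hS h
  have main : ∀ i τ : ℕ, |cov[fun ω => localTerm φ S x h (X i ω, Y i ω),
      fun ω => localTerm φ S x h (X (i + τ) ω, Y (i + τ) ω); μ]| ≤ p * b τ := by
    intro i τ
    set c := |cov[fun ω => localTerm φ S x h (X i ω, Y i ω),
      fun ω => localTerm φ S x h (X (i + τ) ω, Y (i + τ) ω); μ]| with hc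
    have hone : ∀ k, μ.real {ω | X k ω ∈ B} ≤ D * p := by
      intro k
      have h1 := congrArg (fun ν => ν.real (Prod.fst ⁻¹' B)) (hmix.stationary.map_eq hV k)
      simp only [map_measureReal_apply (hV _) (measurable_fst hB)] at h1
      exact h1.trans_le hb1
    have htwo : μ.real ({ω | X i ω ∈ B} ∩ {ω | X (i + τ) ω ∈ B})
        = μ.real ({ω | X 0 ω ∈ B} ∩ {ω | X τ ω ∈ B}) := by
      have h1 := congrArg (fun ν => ν.real ((Prod.fst ⁻¹' B) ×ˢ (Prod.fst ⁻¹' B)))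
        (hmix.stationary.map_pair hV i 0 τ)
      simp only [map_measureReal_apply ((hV _).prodMk (hV _))
        ((measurable_fst hB).prod (measurable_fst hB)), zero_add] at h1
      rw [add_comm i τ]
      exact h1
    have hcov : c ≤ C ^ 2 * (μ.real ({ω | X 0 ω ∈ B} ∩ {ω | X τ ω ∈ B}) + D * p * (D * p)) := by
      have h1 := abs_covariance_le_of_support (μ := μ) (hf.comp (hV i)) (hf.comp (hV (i + τ)))
        (hX i hB) (hX (i + τ) hB) hC0 (fun ω => abs_localTerm_le hC h _)
        (fun ω => abs_localTerm_le hC h _) (fun ω hω => localTerm_eq_zero hR hh hω)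
        (fun ω hω => localTerm_eq_zero hR hh hω)
      refine h1.trans (mul_le_mul_of_nonneg_left (add_le_add htwo.le ?_) (by positivity))
      exact mul_le_mul (hone i) (hone (i + τ)) measureReal_nonneg (by positivity)
    by_cases hτ : τ < N
    · have h1 : c ≤ p * G := by
        -- At short lags the joint probability is bounded by that of a single visit, which still
        -- gives one factor `p`.
        have h2 : μ.real ({ω | X 0 ω ∈ B} ∩ {ω | X τ ω ∈ B}) ≤ D * p :=
          (measureReal_mono Set.inter_subset_left).trans hb1
        have hp1 : p ≤ 1 := pow_le_one₀ hh.le hh1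
        calc c ≤ C ^ 2 * (D * p + D * p * (D * 1)) := hcov.trans (by gcongr)
          _ ≤ C ^ 2 * (D * p + D * p * (D * 1)) + C ^ 2 * (D * p) :=
            le_add_of_nonneg_right (by positivity)
          _ = p * G := by rw [hG]; ring
      refine h1.trans (mul_le_mul_of_nonneg_left ?_ hp0.le)
      simp only [hb, Int.natAbs_natCast, if_pos hτ, mul_one]
      exact le_add_of_nonneg_right (by positivity)
    · have hτ' : N ≤ τ := not_lt.1 hτ
      have h1 : c ≤ G * p ^ 2 := by
        calc c ≤ C ^ 2 * (D * p ^ 2 + D * p * (D * p)) :=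
              hcov.trans (by gcongr; exact hb2 τ ((le_max_left _ _).trans hτ'))
          _ ≤ C ^ 2 * (D * p ^ 2 + D * p * (D * p)) + C ^ 2 * (D * p ^ 2) :=
            le_add_of_nonneg_right (by positivity)
          _ = _ := by rw [hG]; ring
      have h2 : c ≤ 4 * C ^ 2 * A * (τ : ℝ) ^ (-(2 + δ)) := by
        have h3 := abs_covariance_le_mixingCoeff hV μ hf (fun v => abs_localTerm_le hC h v) i τ
        have h4 := hi₁ τ ((le_max_right _ _).trans hτ')
        rw [Real.norm_of_nonneg (mixingCoeff_nonneg _ _ _),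
          Real.norm_of_nonneg (by positivity)] at h4
        calc c ≤ _ := h3
          _ ≤ 4 * C ^ 2 * (A * (τ : ℝ) ^ (-(2 + δ))) := by gcongr
          _ = _ := by ring
      have hsq : ((τ : ℝ) ^ (-(1 + δ / 2))) ^ 2 = (τ : ℝ) ^ (-(2 + δ)) := by
        rw [← Real.rpow_natCast, ← Real.rpow_mul (by positivity)]
        congr 1
        push_cast
        ring
      -- Interpolation: multiplying `h1` and `h2` bounds `c ^ 2`, and taking the square root gives
      -- `p` times a summable power of the lag.
      have hc2 : c ≤ p * (√H * (τ : ℝ) ^ (-(1 + δ / 2))) := by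
        refine le_of_sq_le_sq ?_ (by positivity)
        calc c ^ 2 = c * c := sq c
          _ ≤ G * p ^ 2 * (4 * C ^ 2 * A * (τ : ℝ) ^ (-(2 + δ))) :=
            mul_le_mul h1 h2 (abs_nonneg _) (by positivity)
          _ = _ := by
            rw [mul_pow, mul_pow, hsq, Real.sq_sqrt (by positivity), hH]
            ring
      refine hc2.trans (mul_le_mul_of_nonneg_left ?_ hp0.le)
      simp only [hb, Int.natAbs_natCast, if_neg hτ, mul_zero, zero_add, Int.cast_natCast,
        Nat.abs_cast, le_refl]
  intro i j
  rcases le_total i j with hij | hij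
  · obtain ⟨τ, rfl⟩ := Nat.exists_eq_add_of_le hij
    simpa using main i τ
  · obtain ⟨τ, rfl⟩ := Nat.exists_eq_add_of_le hij
    rw [covariance_comm]
    have h1 : b ((j : ℤ) - ((j + τ : ℕ) : ℤ)) = b τ := by
      simp [hb]
    rw [h1]
    exact main j τ

/-- Integrate out the response given the predictor, then substitute `v = x + h • u`; the Jacobian is
`h ^ w`. -/
lemma integral_localTerm {μ : Measure Ω} [IsProbabilityMeasure μ]
    {X : ℕ → Ω → EuclideanSpace ℝ (Fin w)} {Y : ℕ → Ω → ℝ} (hX : ∀ i, Measurable (X i))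
    (hY : ∀ i, Measurable (Y i))
    {κ : Kernel (EuclideanSpace ℝ (Fin w)) ℝ} [IsMarkovKernel κ]
    (hκ : HasCondDistrib (Y 0) (X 0) κ μ)
    {g : EuclideanSpace ℝ (Fin w) → ℝ} (hg : IsDensity (μ.map (X 0)) g)
    (hφ : Measurable φ) {C : ℝ} (hC : ∀ u, |φ u| ≤ C) (hS : MeasurableSet S) {h : ℝ}
    (hh : 0 < h) :
    ∫ ω, localTerm φ S x h (X 0 ω, Y 0 ω) ∂μ
      = h ^ w * ∫ u, φ u * ((κ (x + h • u)).real S * g (x + h • u)) := by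
  have hf := measurable_localTerm (x := x) hφ hS h
  have : IsProbabilityMeasure (μ.map (X 0)) :=
    Measure.isProbabilityMeasure_map (hX 0).aemeasurable
  have h1 : ∫ ω, localTerm φ S x h (X 0 ω, Y 0 ω) ∂μ
      = ∫ v, localTerm φ S x h v ∂(μ.map (X 0) ⊗ₘ κ) := by
    rw [← (show HasLaw _ _ μ from hκ).map_eq, integral_map ((hX 0).prodMk (hY 0)).aemeasurable
      hf.aestronglyMeasurable]
  have h2 : ∀ u, ∫ y, localTerm φ S x h (u, y) ∂κ u = φ (h⁻¹ • (u - x)) * (κ u).real S := by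
    intro u
    simp only [localTerm]
    rw [integral_const_mul, integral_indicator_const _ hS, smul_eq_mul, mul_one]
  rw [h1, Measure.integral_compProd (Integrable.of_bound hf.aestronglyMeasurable C
    (ae_of_all _ fun v => abs_localTerm_le hC h v))]
  simp_rw [h2]
  rw [hg.eq_withDensity, integral_withDensity_eq_integral_toReal_smul
    hg.measurable.ennreal_ofReal (ae_of_all _ fun _ => by simp)]
  have h3 := Measure.integral_comp_inv_smul volume
    (fun u => φ u * ((κ (x + h • u)).real S * g (x + h • u))) h
  rw [finrank_euclideanSpace_fin, abs_of_pos (by positivity), smul_eq_mul] at h3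
  rw [← h3, ← integral_sub_right_eq_self
    (fun v => φ (h⁻¹ • v) * ((κ (x + h • h⁻¹ • v)).real S * g (x + h • h⁻¹ • v))) x]
  refine integral_congr_ae (ae_of_all _ fun v => ?_)
  simp only [ENNReal.toReal_ofReal (hg.nonneg v), smul_inv_smul₀ hh.ne', smul_eq_mul,
    add_sub_cancel]
  ring

/-- Since `φ` vanishes outside a ball of radius `R`, only values of `q` within `h * R` of `x` enter.
Continuity at the single point `x` therefore supplies both the dominating constant and the pointwise
limit. -/
lemma tendsto_integral_localized {q : EuclideanSpace ℝ (Fin w) → ℝ} (hq : Measurable q)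
    (hqx : ContinuousAt q x) (hφ : Measurable φ) {C R : ℝ} (hC : ∀ u, |φ u| ≤ C)
    (hR : ∀ u, R < ‖u‖ → φ u = 0) :
    Tendsto (fun h : ℝ => ∫ u, φ u * q (x + h • u)) (𝓝[>] 0) (𝓝 ((∫ u, φ u) * q x)) := by
  have hC0 : 0 ≤ C := (abs_nonneg _).trans (hC 0)
  rw [← integral_mul_const]
  set B := Metric.closedBall (0 : EuclideanSpace ℝ (Fin w)) R with hBdef
  have hB : MeasurableSet B := Metric.isClosed_closedBall.measurableSet
  refine tendsto_integral_filter_of_dominated_convergence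
    (B.indicator fun _ => C * (|q x| + 1)) ?_ ?_ ?_ ?_
  · exact Eventually.of_forall fun h =>
      (hφ.mul (hq.comp (by fun_prop))).aestronglyMeasurable
  · have hnear : ∀ᶠ v in 𝓝 x, |q v| ≤ |q x| + 1 :=
      (hqx.abs.eventually (gt_mem_nhds (lt_add_one |q x|))).mono fun v hv => hv.le
    obtain ⟨r, hr, hball⟩ := Metric.eventually_nhds_iff.1 hnear
    have hsmall : ∀ᶠ h in 𝓝[>] (0 : ℝ), h * R < r := by
      have : Tendsto (fun h : ℝ => h * R) (𝓝[>] 0) (𝓝 (0 * R)) :=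
        ((continuous_id.mul continuous_const).tendsto 0).mono_left nhdsWithin_le_nhds
      exact this.eventually (gt_mem_nhds (by simpa using hr))
    filter_upwards [hsmall, self_mem_nhdsWithin] with h hhr (hh : 0 < h)
    refine ae_of_all _ fun u => ?_
    by_cases hu : u ∈ B
    · rw [Set.indicator_of_mem hu, norm_mul]
      refine mul_le_mul (hC u) (hball ?_) (norm_nonneg _) hC0
      rw [dist_eq_norm, add_sub_cancel_left, norm_smul, Real.norm_of_nonneg hh.le]
      have : ‖u‖ ≤ R := by simpa [hBdef] using hu
      exact (mul_le_mul_of_nonneg_left this hh.le).trans_lt hhr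
    · rw [Set.indicator_of_notMem hu, hR u (by simpa [hBdef] using hu)]
      simp
  · exact (integrable_indicator_iff hB).2
      (integrableOn_const (isCompact_closedBall _ _).measure_ne_top)
  · refine ae_of_all _ fun u => Tendsto.const_mul _ ?_
    have : Tendsto (fun h : ℝ => x + h • u) (𝓝[>] 0) (𝓝 x) := by
      have h1 : Tendsto (fun h : ℝ => x + h • u) (𝓝 0) (𝓝 (x + (0 : ℝ) • u)) :=
        (continuous_const.add (continuous_id.smul continuous_const)).tendsto 0
      simpa using h1.mono_left nhdsWithin_le_nhds
    exact hqx.tendsto.comp this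

lemma BandwidthAssumption.tendsto_mul_pow {δ : ℝ} (hδ : 0 < δ) {h : ℕ → ℝ}
    (hh : BandwidthAssumption w δ h) : Tendsto (fun n : ℕ => (n : ℝ) * h n ^ w) atTop atTop := by
  refine tendsto_atTop_mono' _ ?_ hh.tendsto_atTop
  filter_upwards [hh.tendsto_zero.eventually (eventually_le_nhds one_pos)] with n hn
  refine mul_le_mul_of_nonneg_left ?_ n.cast_nonneg
  rw [← Real.rpow_natCast]
  -- For `h ≤ 1` a larger exponent gives a smaller power, and `w (1 + 2/δ) ≥ w`.
  refine Real.rpow_le_rpow_of_exponent_ge (hh.pos n) hn ?_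
  have : (0 : ℝ) ≤ w * (2 / δ) := by positivity
  linarith

/-- The localized average of `localTerm φ S` over `n` observations. -/
noncomputable def localAverage (φ : EuclideanSpace ℝ (Fin w) → ℝ) (S : Set ℝ)
    (x : EuclideanSpace ℝ (Fin w)) (h : ℝ) {n : ℕ} (X : Fin n → EuclideanSpace ℝ (Fin w))
    (Y : Fin n → ℝ) : ℝ :=
  ((n : ℝ) * h ^ w)⁻¹ * ∑ i, localTerm φ S x h (X i, Y i)

/-- The law of large numbers for localized averages. -/
lemma tendstoInMeasure_localAverage {μ : Measure Ω} [IsProbabilityMeasure μ]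
    {X : ℕ → Ω → EuclideanSpace ℝ (Fin w)} {Y : ℕ → Ω → ℝ} (hX : ∀ i, Measurable (X i))
    (hY : ∀ i, Measurable (Y i)) {δ : ℝ} (hδ : 0 < δ)
    (hmix : MixingAssumption (fun i ω => (X i ω, Y i ω)) μ δ)
    {κ : Kernel (EuclideanSpace ℝ (Fin w)) ℝ} [IsMarkovKernel κ]
    (hκ : HasCondDistrib (Y 0) (X 0) κ μ) {g : EuclideanSpace ℝ (Fin w) → ℝ}
    (hg : IsDensity (μ.map (X 0)) g) (hsmooth : SmoothnessAssumption μ X κ g x)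
    {h : ℕ → ℝ} (hh : BandwidthAssumption w δ h)
    (hφ : Measurable φ) {C R : ℝ} (hC : ∀ u, |φ u| ≤ C) (hR0 : 0 ≤ R)
    (hR : ∀ u, R < ‖u‖ → φ u = 0) (hS : MeasurableSet S)
    (hκS : ContinuousAt (fun u => (κ u).real S) x) :
    TendstoInMeasure μ (fun (n : ℕ) ω =>
        localAverage φ S x (h n) (fun i : Fin n => X i ω) (fun i : Fin n => Y i ω))
      atTop fun _ => (∫ u, φ u) * ((κ x).real S * g x) := by
  obtain ⟨b, hb, hb0, hcov⟩ :=
    exists_summable_covariance_bound hX hY hδ hmix hg hsmooth hφ hC hR0 hR hS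
  have hV : ∀ i, Measurable fun ω => (X i ω, Y i ω) := fun i => (hX i).prodMk (hY i)
  have hhlim : Tendsto h atTop (𝓝[>] 0) :=
    tendsto_nhdsWithin_iff.2 ⟨hh.tendsto_zero, Eventually.of_forall hh.pos⟩
  have hf : ∀ h, Measurable (localTerm φ S x h) := measurable_localTerm hφ hS
  have hmem : ∀ h i, MemLp (fun ω => localTerm φ S x h (X i ω, Y i ω)) 2 μ := fun h i =>
    memLp_two_of_abs_le ((hf h).comp (hV i)) fun ω => abs_localTerm_le hC h _
  refine tendstoInMeasure_of_variance ?_ ?_ ?_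
  · intro n
    exact (memLp_finsetSum (Finset.univ : Finset (Fin n)) fun i _ => hmem (h n) i).const_mul _
  · have hq : Measurable fun u => (κ u).real S * g u :=
      (κ.measurable_coe hS).ennreal_toReal.mul hg.measurable
    refine ((tendsto_integral_localized hq (hκS.mul hsmooth.density_continuousAt) hφ hC hR).comp hhlim).congr' ?_
    filter_upwards [eventually_gt_atTop 0] with n hn
    have hmean : ∀ i, ∫ ω, localTerm φ S x (h n) (X i ω, Y i ω) ∂μ
        = h n ^ w * ∫ u, φ u * ((κ (x + h n • u)).real S * g (x + h n • u)) := by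
      intro i
      rw [← integral_localTerm hX hY hκ hg hφ hC hS (hh.pos n),
        ← integral_map (f := localTerm φ S x (h n)) (hV i).aemeasurable
          (hf (h n)).aestronglyMeasurable,
        ← integral_map (f := localTerm φ S x (h n)) (hV 0).aemeasurable
          (hf (h n)).aestronglyMeasurable, hmix.stationary.map_eq hV i]
    have hp : 0 < h n ^ w := pow_pos (hh.pos n) w
    simp only [localAverage, Function.comp]
    rw [integral_const_mul, integral_finsetSum (Finset.univ : Finset (Fin n)) fun i _ =>
       (hmem (h n) i).integrable one_le_two]
    simp only [hmean, Finset.sum_const, Finset.card_univ, Fintype.card_fin, nsmul_eq_mul]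
    have : (n : ℝ) ≠ 0 := by positivity
    field_simp
  · have hlim : Tendsto (fun n : ℕ => (∑' k, b k) * ((n : ℝ) * h n ^ w)⁻¹) atTop (𝓝 0) := by
      simpa using (hh.tendsto_mul_pow hδ).inv_tendsto_atTop.const_mul (∑' k, b k)
    refine tendsto_of_tendsto_of_tendsto_of_le_of_le' tendsto_const_nhds hlim
      (Eventually.of_forall fun n => variance_nonneg _ _) ?_
    filter_upwards [hhlim.eventually hcov, eventually_gt_atTop 0] with n hn hn0
    have hp : 0 < h n ^ w := pow_pos (hh.pos n) w
    have hn' : (0 : ℝ) < n := by positivity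
    simp only [localAverage]
    rw [variance_const_mul]
    calc _ ≤ (((n : ℝ) * h n ^ w)⁻¹) ^ 2 * (h n ^ w * (n * ∑' k, b k)) := by
          gcongr
          exact variance_sum_le (fun i => hmem (h n) i) hb hb0 (fun i j => hn i j) hp.le
      _ = _ := by field_simp

end LocalTerm

/-! ### Lagrange duality for the adjustment weights. -/

section EmpiricalLikelihood

lemma log_one_add_le_sub_sq {t : ℝ} (ht : |t| ≤ 1 / 5) :
    Real.log (1 + t) ≤ t - t ^ 2 / 4 := by
  have h1 := Real.abs_log_sub_add_sum_range_le (x := -t) (by rw [abs_neg]; linarith) 2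
  rw [abs_neg, sub_neg_eq_add] at h1
  simp only [Finset.sum_range_succ, Finset.sum_range_zero] at h1
  norm_num at h1
  -- The second-order Taylor remainder takes at most half of the quadratic term `t ^ 2 / 2`; for
  -- `|t| ≤ 1/5` one has `|t| / (1 - |t|) ≤ 1/4`, so `1/5` is exactly the threshold.
  have h2 : |t| ^ 3 / (1 - |t|) ≤ t ^ 2 / 4 := by
    rw [div_le_iff₀ (by linarith), ← sq_abs t]
    nlinarith [sq_nonneg |t|, abs_nonneg t]
  have h3 := (abs_le.1 (h1.trans h2)).2
  linarith

open scoped RealInnerProductSpace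

/-- Existence of a small Lagrange multiplier. -/
lemma exists_multiplier {E ι : Type*} [Fintype ι] [NormedAddCommGroup E] [InnerProductSpace ℝ E]
    [FiniteDimensional ℝ E] {W : ι → E} {C r a ε c : ℝ} (hW : ∀ i, ‖W i‖ ≤ C) (hr : 0 < r)
    (hrC : r * C ≤ 1 / 5) (ha : 0 < a) (hmean : ∀ l : E, ∑ i, ⟪l, W i⟫ ≤ a * (ε * ‖l‖))
    (hsq : ∀ l : E, a * (c * ‖l‖ ^ 2) ≤ ∑ i, ⟪l, W i⟫ ^ 2) (hε : 4 * ε < c * r) :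
    ∃ l : E, (∀ i, |⟪l, W i⟫| ≤ r * C) ∧ ∑ i, (1 + ⟪l, W i⟫)⁻¹ • W i = 0 := by
  have hle : ∀ l ∈ Metric.closedBall (0 : E) r, ∀ i, |⟪l, W i⟫| ≤ r * C := by
    intro l hl i
    refine (abs_real_inner_le_norm l (W i)).trans ?_
    exact mul_le_mul (by simpa using hl) (hW i) (norm_nonneg _) hr.le
  have hpos : ∀ l ∈ Metric.closedBall (0 : E) r, ∀ i, 0 < 1 + ⟪l, W i⟫ := by
    intro l hl i
    have := (abs_le.1 (hle l hl i)).1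
    linarith
  set D : E → ℝ := fun l => ∑ i, Real.log (1 + ⟪l, W i⟫) with hD
  have hcont : ContinuousOn D (Metric.closedBall 0 r) := by
    refine continuousOn_finsetSum _ fun i _ => ContinuousOn.log (by fun_prop) ?_
    exact fun l hl => (hpos l hl i).ne'
  obtain ⟨l, hl, hmax⟩ := (isCompact_closedBall (0 : E) r).exists_isMaxOn
    ⟨0, Metric.mem_closedBall_self hr.le⟩ hcont
  refine ⟨l, hle l hl, ?_⟩
  -- A maximizer on the sphere would have `D l ≤ a r (ε - c r / 4) < 0 = D 0`; hence the maximum is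
  -- interior and every directional derivative vanishes there.
  have hlt : ‖l‖ < r := by
    refine lt_of_le_of_ne (by simpa using hl) fun hlr => ?_
    have h0 : D 0 ≤ D l := hmax (Metric.mem_closedBall_self hr.le)
    have h1 : D l ≤ ∑ i, (⟪l, W i⟫ - ⟪l, W i⟫ ^ 2 / 4) :=
      Finset.sum_le_sum fun i _ => log_one_add_le_sub_sq ((hle l hl i).trans hrC)
    rw [Finset.sum_sub_distrib, ← Finset.sum_div] at h1
    have h2 := hmean l
    have h3 := hsq l
    rw [hlr] at h2 h3
    have h4 : D 0 = 0 := by simp [hD]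
    have h5 : 0 < a * r * (c * r - 4 * ε) := by
      have : 0 < c * r - 4 * ε := by linarith
      positivity
    nlinarith
  refine ext_inner_left ℝ fun e => ?_
  rw [inner_zero_right, inner_sum]
  have hderiv : HasDerivAt (fun t : ℝ => D (l + t • e))
      (∑ i, ⟪e, W i⟫ / (1 + ⟪l, W i⟫)) 0 := by
    simp only [hD]
    refine HasDerivAt.fun_sum fun i _ => ?_
    have h1 : HasDerivAt (fun t : ℝ => 1 + ⟪l + t • e, W i⟫) ⟪e, W i⟫ 0 := by
      simp only [inner_add_left, real_inner_smul_left]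
      simpa using (((hasDerivAt_id (0 : ℝ)).mul_const ⟪e, W i⟫).const_add ⟪l, W i⟫).const_add 1
    have h2 := h1.log (by simpa using (hpos l hl i).ne')
    simpa using h2
  have hloc : IsLocalMax (fun t : ℝ => D (l + t • e)) 0 := by
    have h1 : Tendsto (fun t : ℝ => l + t • e) (𝓝 0) (𝓝 l) := by
      have : Continuous fun t : ℝ => l + t • e := by fun_prop
      simpa using this.tendsto 0
    have h2 : ∀ᶠ m in 𝓝 l, D m ≤ D l :=
      hmax.isLocalMax (Metric.closedBall_mem_nhds_of_mem (by simpa using hlt))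
    simpa [IsLocalMax, IsMaxFilter] using h1.eventually h2
  have hzero := hloc.hasDerivAt_eq_zero hderiv
  rw [← hzero]
  refine Finset.sum_congr rfl fun i _ => ?_
  rw [real_inner_smul_right, div_eq_inv_mul]

variable {w n : ℕ} {K : EuclideanSpace ℝ (Fin w) → ℝ} {h : ℝ}
  {X : Fin n → EuclideanSpace ℝ (Fin w)} {x : EuclideanSpace ℝ (Fin w)}

lemma sum_scaledKernel_smul (hh : 0 < h) (p : Fin n → ℝ) :
    ∑ i, (p i * scaledKernel K h (X i - x)) • (X i - x)
      = ((h ^ w)⁻¹ * h) • ∑ i, p i • K (h⁻¹ • (X i - x)) • h⁻¹ • (X i - x) := by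
  rw [Finset.smul_sum]
  refine Finset.sum_congr rfl fun i _ => ?_
  simp only [scaledKernel, smul_smul]
  congr 1
  field_simp

lemma moment_eq_zero_iff (hh : 0 < h) (p : Fin n → ℝ) :
    ∑ i, (p i * scaledKernel K h (X i - x)) • (X i - x) = 0
      ↔ ∑ i, p i • K (h⁻¹ • (X i - x)) • h⁻¹ • (X i - x) = 0 := by
  rw [sum_scaledKernel_smul hh, smul_eq_zero, or_iff_right (by positivity)]

/-- The dual characterization of the adjustment weights. -/
lemma adjustmentWeights_eq_of_multiplier (hn : 0 < n) (hh : 0 < h) {l : EuclideanSpace ℝ (Fin w)}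
    (hpos : ∀ i, 0 < 1 + ⟪l, K (h⁻¹ • (X i - x)) • h⁻¹ • (X i - x)⟫)
    (hl : ∑ i, (1 + ⟪l, K (h⁻¹ • (X i - x)) • h⁻¹ • (X i - x)⟫)⁻¹ •
      K (h⁻¹ • (X i - x)) • h⁻¹ • (X i - x) = 0) (i : Fin n) :
    n * adjustmentWeights K h X x i
      = (1 + ⟪l, K (h⁻¹ • (X i - x)) • h⁻¹ • (X i - x)⟫)⁻¹ := by
  have hn' : (0 : ℝ) < n := by exact_mod_cast hn
  set W := fun i => K (h⁻¹ • (X i - x)) • h⁻¹ • (X i - x) with hW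
  set t := fun i => ⟪l, W i⟫ with ht
  change ∀ i, 0 < 1 + t i at hpos
  change ∑ i, (1 + t i)⁻¹ • W i = 0 at hl
  set p := fun i => (n : ℝ)⁻¹ * (1 + t i)⁻¹ with hp
  have hp0 : ∀ i, 0 < p i := fun i => mul_pos (inv_pos.2 hn') (inv_pos.2 (hpos i))
  -- Pairing the multiplier equation with `l` gives `∑ t i / (1 + t i) = 0`, and `1/(1 + t) + t/(1 +
  -- t) = 1`. Normalization thus needs no second multiplier.
  have hsum : ∑ i, (1 + t i)⁻¹ = n := by
    have h1 : ∑ i, (1 + t i)⁻¹ * t i = 0 := by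
      have h2 := congrArg (fun v => ⟪l, v⟫) hl
      simpa only [inner_sum, real_inner_smul_right, inner_zero_right] using h2
    have h2 : ∑ i, ((1 + t i)⁻¹ + (1 + t i)⁻¹ * t i) = ∑ _i : Fin n, (1 : ℝ) :=
      Finset.sum_congr rfl fun i _ => by
        have := (hpos i).ne'
        field_simp
    rw [Finset.sum_add_distrib, h1, add_zero] at h2
    simpa using h2
  have hfeas : IsFeasible K h X x p := by
    refine ⟨hp0, ?_, ?_⟩
    · rw [← Finset.mul_sum, hsum, inv_mul_cancel₀ hn'.ne']
    · rw [moment_eq_zero_iff hh]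
      simp only [hp, mul_smul]
      rw [← Finset.smul_sum]
      simp only [hW] at hl
      rw [hl, smul_zero]
  -- Since `1 / p i = n (1 + t i)`, the ratios `q i / p i` average to `1` for every feasible `q`.
  -- With `log s ≤ s - 1`, strict unless `s = 1`, this gives both maximality and uniqueness.
  have hratio : ∀ q, IsFeasible K h X x q → ∑ i, (q i / p i - 1) = 0 := by
    intro q hq
    have h1 := (moment_eq_zero_iff hh q).1 hq.moment
    have h2 : ∑ i, q i * t i = 0 := by
      have h3 := congrArg (fun v => ⟪l, v⟫) h1
      rw [inner_sum, inner_zero_right] at h3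
      rw [← h3]
      exact Finset.sum_congr rfl fun i _ => (real_inner_smul_right l (W i) (q i)).symm
    have h4 : ∀ i, q i / p i - 1 = n * q i + n * (q i * t i) - 1 := by
      intro i
      simp only [hp]
      have := (hpos i).ne'
      field_simp
    simp only [h4]
    rw [Finset.sum_sub_distrib, Finset.sum_add_distrib, ← Finset.mul_sum, ← Finset.mul_sum,
      hq.sum_eq_one, h2]
    simp
  have hlog : ∀ q, IsFeasible K h X x q →
      ∑ i, (Real.log (q i) - Real.log (p i)) = ∑ i, Real.log (q i / p i) := fun q hq =>
    Finset.sum_congr rfl fun i _ => (Real.log_div (hq.pos i).ne' (hp0 i).ne').symm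
  have hadj : IsAdjustment K h X x p := by
    refine ⟨hfeas, fun q hq => ?_⟩
    have h1 : ∑ i, Real.log (q i / p i) ≤ ∑ i, (q i / p i - 1) :=
      Finset.sum_le_sum fun i _ => Real.log_le_sub_one_of_pos (div_pos (hq.pos i) (hp0 i))
    rw [hratio q hq, ← hlog q hq, Finset.sum_sub_distrib] at h1
    linarith
  have huniq : ∀ q, IsAdjustment K h X x q → q = p := by
    intro q hq
    by_contra hne
    obtain ⟨j, hj⟩ := Function.ne_iff.1 hne
    have h1 : ∑ i, Real.log (q i / p i) < ∑ i, (q i / p i - 1) := by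
      refine Finset.sum_lt_sum (fun i _ => Real.log_le_sub_one_of_pos
        (div_pos (hq.feasible.pos i) (hp0 i))) ⟨j, Finset.mem_univ j, ?_⟩
      refine Real.log_lt_sub_one_of_pos (div_pos (hq.feasible.pos j) (hp0 j)) fun h2 => hj ?_
      exact (div_eq_one_iff_eq (hp0 j).ne').1 h2
    rw [hratio q hq.feasible, ← hlog q hq.feasible, Finset.sum_sub_distrib] at h1
    have := hq.maximal p hfeas
    linarith
  have hex : ∃ p : Fin n → ℝ, IsAdjustment K h X x p := ⟨p, hadj⟩
  have hval : adjustmentWeights K h X x = p := by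
    unfold adjustmentWeights
    rw [dif_pos hex]
    -- The weights are an arbitrary choice among maximizers, so uniqueness is what identifies them
    -- with `p`.
    exact huniq _ hex.choose_spec
  rw [hval]
  simp only [hp]
  rw [mul_inv_cancel_left₀ hn'.ne']

lemma adjustmentWeights_nonneg (i : Fin n) : 0 ≤ adjustmentWeights K h X x i := by
  unfold adjustmentWeights
  split_ifs with hp
  · exact (hp.choose_spec.feasible.pos i).le
  · positivity

lemma abs_inv_one_add_sub_one_le {t s : ℝ} (hts : |t| ≤ s) (hs : s ≤ 1 / 5) :
    |(1 + t)⁻¹ - 1| ≤ 2 * s := by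
  have h1 := abs_le.1 hts
  have hpos : 0 < 1 + t := by linarith
  have h2 : (1 + t)⁻¹ - 1 = -t / (1 + t) := by field_simp; ring
  rw [h2, abs_div, abs_neg, abs_of_pos hpos, div_le_iff₀ hpos]
  nlinarith [abs_nonneg t]

end EmpiricalLikelihood

/-! ### Comparison of the reweighted estimator with unweighted local averages. -/

section EstimatedCDF

variable {w n : ℕ} {K : EuclideanSpace ℝ (Fin w) → ℝ} {h : ℝ}
  {X : Fin n → EuclideanSpace ℝ (Fin w)} {Y : Fin n → ℝ} {x : EuclideanSpace ℝ (Fin w)}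

lemma scaledKernel_nonneg (hK : ∀ u, 0 ≤ K u) (hh : 0 < h) (u : EuclideanSpace ℝ (Fin w)) :
    0 ≤ scaledKernel K h u :=
  mul_nonneg (by positivity) (hK _)

lemma estCDF_mono (hK : ∀ u, 0 ≤ K u) (hh : 0 < h) : Monotone (estCDF K h X Y x) := by
  intro a b hab
  refine Finset.sum_le_sum fun i _ => mul_le_mul_of_nonneg_left ?_ ?_
  · exact Set.indicator_le_indicator_of_subset (Set.Iic_subset_Iic.2 hab)
      (fun _ => zero_le_one) _
  · have hterm : ∀ j, 0 ≤ adjustmentWeights K h X x j * scaledKernel K h (X j - x) := fun j =>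
      mul_nonneg (adjustmentWeights_nonneg j) (scaledKernel_nonneg hK hh _)
    exact div_nonneg (hterm i) (Finset.sum_nonneg fun j _ => hterm j)

/-- The weighted kernel sum over the event `S` for the response. -/
noncomputable def weightedSum (K : EuclideanSpace ℝ (Fin w) → ℝ) (S : Set ℝ)
    (x : EuclideanSpace ℝ (Fin w)) (h : ℝ) (X : Fin n → EuclideanSpace ℝ (Fin w))
    (Y : Fin n → ℝ) : ℝ :=
  ∑ i, adjustmentWeights K h X x i * scaledKernel K h (X i - x) *
    S.indicator (fun _ => (1 : ℝ)) (Y i)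

lemma estCDF_eq_div (b : ℝ) : estCDF K h X Y x b
    = weightedSum K (Set.Iic b) x h X Y / weightedSum K Set.univ x h X Y := by
  simp only [estCDF, finalWeights, weightedSum, Finset.sum_div, Set.indicator_univ, mul_one]
  exact Finset.sum_congr rfl fun i _ => by ring

lemma weightedSum_bounds (hK : ∀ u, 0 ≤ K u) (hh : 0 < h) (hn : 0 < n) {η : ℝ}
    (hη : ∀ i, |n * adjustmentWeights K h X x i - 1| ≤ η) (S : Set ℝ) :
    (1 - η) * localAverage K S x h X Y ≤ weightedSum K S x h X Y ∧
      weightedSum K S x h X Y ≤ (1 + η) * localAverage K S x h X Y := by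
  have hn' : (0 : ℝ) < n := by exact_mod_cast hn
  have hsum : weightedSum K S x h X Y = ((n : ℝ) * h ^ w)⁻¹ *
      ∑ i, n * adjustmentWeights K h X x i * localTerm K S x h (X i, Y i) := by
    simp only [weightedSum, localTerm, scaledKernel, Finset.mul_sum]
    refine Finset.sum_congr rfl fun i _ => ?_
    field_simp
  have hterm : ∀ i, 0 ≤ localTerm K S x h (X i, Y i) := fun i =>
    mul_nonneg (hK _) (Set.indicator_nonneg (fun _ _ => zero_le_one) _)
  have hc : 0 ≤ ((n : ℝ) * h ^ w)⁻¹ := by positivity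
  rw [hsum, localAverage, mul_left_comm (1 - η), mul_left_comm (1 + η),
    Finset.mul_sum _ _ (1 - η), Finset.mul_sum _ _ (1 + η)]
  constructor
  · refine mul_le_mul_of_nonneg_left (Finset.sum_le_sum fun i _ =>
      mul_le_mul_of_nonneg_right ?_ (hterm i)) hc
    linarith [(abs_le.1 (hη i)).1]
  · refine mul_le_mul_of_nonneg_left (Finset.sum_le_sum fun i _ =>
      mul_le_mul_of_nonneg_right ?_ (hterm i)) hc
    linarith [(abs_le.1 (hη i)).2]

lemma weightedSum_nonneg (hK : ∀ u, 0 ≤ K u) (hh : 0 < h) (S : Set ℝ) :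
    0 ≤ weightedSum K S x h X Y :=
  Finset.sum_nonneg fun i _ => mul_nonneg
    (mul_nonneg (adjustmentWeights_nonneg i) (scaledKernel_nonneg hK hh _))
    (Set.indicator_nonneg (fun _ _ => zero_le_one) _)

lemma estCDF_lt (hK : ∀ u, 0 ≤ K u) (hh : 0 < h) (hn : 0 < n) {η β b : ℝ} (hβ : 0 < β)
    (hη : ∀ i, |n * adjustmentWeights K h X x i - 1| ≤ η)
    (hlt : (1 + η) * localAverage K (Set.Iic b) x h X Y
      < β * ((1 - η) * localAverage K Set.univ x h X Y)) :
    estCDF K h X Y x b < β := by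
  have h1 := (weightedSum_bounds (Y := Y) hK hh hn hη (Set.Iic b)).2
  have h2 := (weightedSum_bounds (Y := Y) hK hh hn hη Set.univ).1
  have h3 := weightedSum_nonneg (X := X) (Y := Y) (x := x) hK hh (Set.Iic b)
  have h4 : weightedSum K (Set.Iic b) x h X Y < β * weightedSum K Set.univ x h X Y :=
    h1.trans_lt (hlt.trans_le (mul_le_mul_of_nonneg_left h2 hβ.le))
  -- The strict inequality `h4`, whose left side is nonnegative, itself forces the denominator to be
  -- positive.
  rw [estCDF_eq_div, div_lt_iff₀ (pos_of_mul_pos_right (h3.trans_lt h4) hβ.le)]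
  exact h4

lemma lt_estCDF (hK : ∀ u, 0 ≤ K u) (hh : 0 < h) (hn : 0 < n) {η β b : ℝ} (hβ : 0 < β)
    (hη : ∀ i, |n * adjustmentWeights K h X x i - 1| ≤ η)
    (hlt : β * ((1 + η) * localAverage K Set.univ x h X Y)
      < (1 - η) * localAverage K (Set.Iic b) x h X Y) :
    β < estCDF K h X Y x b := by
  have h1 := (weightedSum_bounds (Y := Y) hK hh hn hη (Set.Iic b)).1
  have h2 := (weightedSum_bounds (Y := Y) hK hh hn hη Set.univ).2
  have h3 := weightedSum_nonneg (X := X) (Y := Y) (x := x) hK hh Set.univ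
  have h4 : β * weightedSum K Set.univ x h X Y < weightedSum K (Set.Iic b) x h X Y :=
    (mul_le_mul_of_nonneg_left h2 hβ.le).trans_lt (hlt.trans_le h1)
  have h5 : weightedSum K (Set.Iic b) x h X Y ≤ weightedSum K Set.univ x h X Y := by
    refine Finset.sum_le_sum fun i _ => mul_le_mul_of_nonneg_left ?_
      (mul_nonneg (adjustmentWeights_nonneg i) (scaledKernel_nonneg hK hh _))
    exact Set.indicator_le_indicator_of_subset (Set.subset_univ _) (fun _ => zero_le_one) _
  rw [estCDF_eq_div, lt_div_iff₀]
  · exact h4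
  · exact ((mul_nonneg hβ.le h3).trans_lt h4).trans_le h5

end EstimatedCDF

/-! ### Generalized inverses. -/

section Quantile

lemma abs_quantile_sub_le {G : ℝ → ℝ} (hG : Monotone G) {β Q ε : ℝ}
    (hlo : G (Q - ε) < β) (hhi : β ≤ G (Q + ε)) : |quantile G β - Q| ≤ ε := by
  have hbdd : ∀ y ∈ {y : ℝ | β ≤ G y}, Q - ε ≤ y := fun y hy =>
    (hG.reflect_lt (hlo.trans_le hy)).le
  have h1 : quantile G β ≤ Q + ε := csInf_le ⟨Q - ε, hbdd⟩ hhi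
  have h2 : Q - ε ≤ quantile G β := le_csInf ⟨Q + ε, hhi⟩ hbdd
  rw [abs_le]
  constructor <;> linarith

lemma condCDF_lt_of_lt_quantile {E : Type*} [MeasurableSpace E] (κ : Kernel E ℝ)
    [IsMarkovKernel κ] (x : E) {β y : ℝ} (hβ : 0 < β)
    (hy : y < quantile (fun b => condCDF κ b x) β) : condCDF κ y x < β := by
  by_contra! hle
  -- Decay at `-∞` bounds the superlevel set from below, without which its `sInf` would not be a
  -- lower bound.
  have hlim : Tendsto (fun b => condCDF κ b x) atBot (𝓝 0) := by
    have h1 := tendsto_cdf_atBot (κ x)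
    exact h1.congr fun b => cdf_eq_real (κ x) b
  obtain ⟨z, hz⟩ := eventually_atBot.1 (hlim.eventually (gt_mem_nhds hβ))
  refine hy.not_ge (csInf_le ⟨z, fun b hb => ?_⟩ hle)
  by_contra! hbz
  exact (hz b hbz.le).not_ge hb

end Quantile

/-! ### Calculus of events with probability tending to one. -/

section HighProbability

variable {Ω : Type*} [MeasurableSpace Ω] {μ : Measure Ω}

/-- The events `P n` have probability tending to one (up to an outer measure). -/
def WithHighProbability (μ : Measure Ω) (P : ℕ → Ω → Prop) : Prop :=
  Tendsto (fun n => μ {ω | ¬ P n ω}) atTop (𝓝 0)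

lemma WithHighProbability.mono {P Q : ℕ → Ω → Prop} (hP : WithHighProbability μ P)
    (h : ∀ᶠ n in atTop, ∀ ω, P n ω → Q n ω) : WithHighProbability μ Q := by
  refine tendsto_of_tendsto_of_tendsto_of_le_of_le' tendsto_const_nhds hP
    (Eventually.of_forall fun _ => zero_le) ?_
  filter_upwards [h] with n hn
  exact measure_mono fun ω hω hPω => hω (hn ω hPω)

lemma WithHighProbability.all {ι : Type*} [Fintype ι] {P : ι → ℕ → Ω → Prop}
    (hP : ∀ i, WithHighProbability μ (P i)) : WithHighProbability μ fun n ω => ∀ i, P i n ω := by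
  have hsum : Tendsto (fun n => ∑ i, μ {ω | ¬ P i n ω}) atTop (𝓝 0) := by
    simpa using tendsto_finsetSum Finset.univ fun i _ => hP i
  refine tendsto_of_tendsto_of_tendsto_of_le_of_le tendsto_const_nhds hsum
    (fun _ => zero_le) fun n => ?_
  refine (measure_mono fun ω hω => ?_).trans
    (measure_iUnion_fintype_le μ fun i => {ω | ¬ P i n ω})
  simpa using hω

lemma WithHighProbability.and {P Q : ℕ → Ω → Prop} (hP : WithHighProbability μ P)
    (hQ : WithHighProbability μ Q) : WithHighProbability μ fun n ω => P n ω ∧ Q n ω := by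
  have h : ∀ b : Bool, WithHighProbability μ (bif b then P else Q) := by
    rintro (_ | _)
    exacts [hQ, hP]
  exact (WithHighProbability.all h).mono (Eventually.of_forall fun n ω hω => ⟨hω true, hω false⟩)

lemma withHighProbability_of_tendstoInMeasure {Z : ℕ → Ω → ℝ} {L : ℝ}
    (hZ : TendstoInMeasure μ Z atTop fun _ => L) {ε : ℝ} (hε : 0 < ε) :
    WithHighProbability μ fun n ω => |Z n ω - L| < ε := by
  simpa [WithHighProbability] using tendstoInMeasure_iff_norm.1 hZ ε hε

lemma tendstoInMeasure_of_withHighProbability {Z : ℕ → Ω → ℝ} {L : ℝ}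
    (hZ : ∀ ε > 0, WithHighProbability μ fun n ω => |Z n ω - L| ≤ ε) :
    TendstoInMeasure μ Z atTop fun _ => L := by
  refine tendstoInMeasure_iff_norm.2 fun ε hε => ?_
  have h1 := (hZ (ε / 2) (by positivity)).mono (Q := fun n ω => |Z n ω - L| < ε)
    (Eventually.of_forall fun n ω hω => hω.trans_lt (half_lt_self hε))
  simpa [WithHighProbability] using h1

end HighProbability

/-! ### From sample moments to near-uniform weights. -/

section Sample

variable {w n : ℕ} {K : EuclideanSpace ℝ (Fin w) → ℝ}

lemma KernelAssumption.integral_coord_mul (hK : KernelAssumption K) (j : Fin w) :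
    ∫ u : EuclideanSpace ℝ (Fin w), u j * K u = 0 := by
  have hint : Integrable fun u : EuclideanSpace ℝ (Fin w) => K u • u :=
    (hK.continuous.smul continuous_id).integrable_of_hasCompactSupport
      hK.compactSupport.smul_right
  have h1 := (EuclideanSpace.proj j : EuclideanSpace ℝ (Fin w) →L[ℝ] ℝ).integral_comp_comm hint
  rw [hK.first_moment, map_zero] at h1
  rw [← h1]
  exact integral_congr_ae (ae_of_all _ fun u => by simp [mul_comm])

open scoped RealInnerProductSpace

lemma sum_coord_mul_le {l : EuclideanSpace ℝ (Fin w)} {m : Fin w → ℝ} {ε : ℝ}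
    (hm : ∀ j, |m j| ≤ ε) : |∑ j, l j * m j| ≤ w * ε * ‖l‖ := by
  calc |∑ j, l j * m j| ≤ ∑ j, |l j * m j| := Finset.abs_sum_le_sum_abs _ _
    _ ≤ ∑ _j : Fin w, ‖l‖ * ε := Finset.sum_le_sum fun j _ => by
        rw [abs_mul]
        exact mul_le_mul (PiLp.norm_apply_le l j) (hm j) (abs_nonneg _) (norm_nonneg _)
    _ = _ := by simp; ring

/-- The matrix `s` is `σ I` plus a perturbation with entries at most `ε`; two applications of the
coordinate bound cost a factor `w` each. -/
lemma le_sum_sum_coord_mul {l : EuclideanSpace ℝ (Fin w)} {s : Fin w → Fin w → ℝ} {σ ε : ℝ}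
    (hs : ∀ j k, |s j k - if j = k then σ else 0| ≤ ε) :
    (σ - w * (w * ε)) * ‖l‖ ^ 2 ≤ ∑ j, l j * ∑ k, l k * s j k := by
  set d : Fin w → Fin w → ℝ := fun j k => s j k - if j = k then σ else 0 with hd
  have h1 : ∑ j, l j * ∑ k, l k * s j k
      = σ * ‖l‖ ^ 2 + ∑ j, l j * ∑ k, l k * d j k := by
    rw [EuclideanSpace.real_norm_sq_eq, Finset.mul_sum, ← Finset.sum_add_distrib]
    refine Finset.sum_congr rfl fun j _ => ?_
    simp only [hd, mul_sub, Finset.sum_sub_distrib, mul_ite, mul_zero, Finset.sum_ite_eq,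
      Finset.mem_univ, if_true]
    ring
  have h2 := sum_coord_mul_le (l := l) (m := fun j => ∑ k, l k * d j k)
    fun j => sum_coord_mul_le (l := l) (hs j)
  have h3 := (abs_le.1 h2).1
  rw [h1]
  nlinarith

variable {h : ℝ} {X : Fin n → EuclideanSpace ℝ (Fin w)} {Y : Fin n → ℝ}
  {x : EuclideanSpace ℝ (Fin w)}

/-- If the localized moments of the sample are close to their limits, then the adjustment weights
are close to uniform. -/
lemma abs_mul_adjustmentWeights_sub_one_le (hn : 0 < n) (hh : 0 < h) {C r ε σ : ℝ}
    (hC : ∀ u : EuclideanSpace ℝ (Fin w), ‖K u • u‖ ≤ C) (hr : 0 < r) (hrC : r * C ≤ 1 / 5)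
    (hmean : ∀ j : Fin w, |localAverage (fun u => u j * K u) Set.univ x h X Y| ≤ ε)
    (hsq : ∀ j k : Fin w, |localAverage (fun u => u j * u k * K u ^ 2) Set.univ x h X Y
      - if j = k then σ else 0| ≤ ε)
    (hε : 4 * (w * ε) < (σ - w * (w * ε)) * r) (i : Fin n) :
    |n * adjustmentWeights K h X x i - 1| ≤ 2 * (r * C) := by
  have hn' : (0 : ℝ) < n := by exact_mod_cast hn
  set a := (n : ℝ) * h ^ w with ha
  have ha0 : 0 < a := by positivity
  set U := fun i => h⁻¹ • (X i - x) with hU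
  have hinner : ∀ (l : EuclideanSpace ℝ (Fin w)) i,
      ⟪l, K (U i) • U i⟫ = ∑ j, l j * (U i j * K (U i)) := by
    intro l i
    rw [PiLp.inner_apply]
    refine Finset.sum_congr rfl fun j _ => ?_
    simp only [PiLp.smul_apply, smul_eq_mul, RCLike.inner_apply, conj_trivial]
    ring
  have hlin : ∀ l : EuclideanSpace ℝ (Fin w), ∑ i, ⟪l, K (U i) • U i⟫
      = a * ∑ j, l j * localAverage (fun u => u j * K u) Set.univ x h X Y := by
    intro l
    simp only [hinner, localAverage, localTerm, Set.indicator_univ, mul_one]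
    rw [Finset.sum_comm, Finset.mul_sum]
    refine Finset.sum_congr rfl fun j _ => ?_
    rw [mul_left_comm, mul_inv_cancel_left₀ ha0.ne', Finset.mul_sum]
  have hquad : ∀ l : EuclideanSpace ℝ (Fin w), ∑ i, ⟪l, K (U i) • U i⟫ ^ 2
      = a * ∑ j, l j * ∑ k, l k *
        localAverage (fun u => u j * u k * K u ^ 2) Set.univ x h X Y := by
    intro l
    have h1 : ∀ j, l j * ∑ k, l k * localAverage (fun u => u j * u k * K u ^ 2) Set.univ x h X Y
        = a⁻¹ * ∑ i, ∑ k, l j * (U i j * K (U i)) * (l k * (U i k * K (U i))) := by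
      intro j
      simp only [localAverage, localTerm, Set.indicator_univ, mul_one]
      rw [Finset.sum_comm, Finset.mul_sum, Finset.mul_sum]
      refine Finset.sum_congr rfl fun k _ => ?_
      rw [mul_left_comm (l k), mul_left_comm (l j), Finset.mul_sum, Finset.mul_sum]
      congr 1
      exact Finset.sum_congr rfl fun i _ => by ring
    simp only [h1]
    rw [← Finset.mul_sum, mul_inv_cancel_left₀ ha0.ne', Finset.sum_comm]
    refine Finset.sum_congr rfl fun i _ => ?_
    rw [hinner, sq, Finset.sum_mul_sum]
  obtain ⟨l, hl, hzero⟩ := exists_multiplier (W := fun i => K (U i) • U i) (a := a)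
    (ε := w * ε) (c := σ - w * (w * ε)) (fun i => hC (U i)) hr hrC ha0
    (fun l => by
      rw [hlin]
      exact mul_le_mul_of_nonneg_left ((le_abs_self _).trans (sum_coord_mul_le hmean)) ha0.le)
    (fun l => by
      rw [hquad]
      exact mul_le_mul_of_nonneg_left (le_sum_sum_coord_mul hsq) ha0.le) hε
  rw [adjustmentWeights_eq_of_multiplier hn hh
    (fun i => by have := (abs_le.1 (hl i)).1; linarith) hzero]
  exact abs_inv_one_add_sub_one_le (hl i) hrC

end Sample

/-! ### Consistency of the weights and of the estimated distribution function. -/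

section Consistency

variable {Ω : Type*} [MeasurableSpace Ω] {w : ℕ} {μ : Measure Ω} [IsProbabilityMeasure μ]
  {X : ℕ → Ω → EuclideanSpace ℝ (Fin w)} {Y : ℕ → Ω → ℝ} {δ : ℝ}
  {κ : Kernel (EuclideanSpace ℝ (Fin w)) ℝ} [IsMarkovKernel κ]
  {g : EuclideanSpace ℝ (Fin w) → ℝ} {x : EuclideanSpace ℝ (Fin w)}
  {K : EuclideanSpace ℝ (Fin w) → ℝ} {h : ℕ → ℝ}

lemma tendstoInMeasure_localAverage_of_continuous (hX : ∀ i, Measurable (X i))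
    (hY : ∀ i, Measurable (Y i)) (hδ : 0 < δ)
    (hmix : MixingAssumption (fun i ω => (X i ω, Y i ω)) μ δ)
    (hκ : HasCondDistrib (Y 0) (X 0) κ μ) (hg : IsDensity (μ.map (X 0)) g)
    (hsmooth : SmoothnessAssumption μ X κ g x) (hh : BandwidthAssumption w δ h)
    {φ : EuclideanSpace ℝ (Fin w) → ℝ} (hφ : Continuous φ) (hφc : HasCompactSupport φ)
    {S : Set ℝ} (hS : MeasurableSet S) (hκS : ContinuousAt (fun u => (κ u).real S) x) :
    TendstoInMeasure μ (fun (n : ℕ) ω =>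
        localAverage φ S x (h n) (fun i : Fin n => X i ω) (fun i : Fin n => Y i ω))
      atTop fun _ => (∫ u, φ u) * ((κ x).real S * g x) := by
  obtain ⟨C, hC⟩ := hφc.exists_bound_of_continuous hφ
  obtain ⟨R, hR⟩ := hφc.isCompact.isBounded.subset_closedBall 0
  refine tendstoInMeasure_localAverage hX hY hδ hmix hκ hg hsmooth hh hφ.measurable hC
    (abs_nonneg R) (fun u hu => ?_) hS hκS
  by_contra hne
  have h1 := hR (subset_tsupport φ hne)
  rw [Metric.mem_closedBall, dist_zero_right] at h1
  exact ((le_abs_self R).trans_lt hu).not_ge h1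

/-- With high probability, the adjustment weights are uniformly close to `1 / n`. -/
lemma withHighProbability_adjustmentWeights (hX : ∀ i, Measurable (X i))
    (hY : ∀ i, Measurable (Y i)) (hδ : 0 < δ)
    (hmix : MixingAssumption (fun i ω => (X i ω, Y i ω)) μ δ)
    (hκ : HasCondDistrib (Y 0) (X 0) κ μ) (hg : IsDensity (μ.map (X 0)) g)
    (hsmooth : SmoothnessAssumption μ X κ g x) (hK : KernelAssumption K)
    (hh : BandwidthAssumption w δ h) {η : ℝ} (hη : 0 < η) :
    WithHighProbability μ fun n ω => ∀ i : Fin n,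
      |n * adjustmentWeights K (h n) (fun i : Fin n => X i ω) x i - 1| ≤ η := by
  obtain ⟨C', hC'⟩ := (hK.compactSupport.smul_right (f' := fun u => u)).exists_bound_of_continuous
    (hK.continuous.smul continuous_id)
  set C := |C'| + 1 with hCdef
  have hC0 : 0 < C := by positivity
  have hC : ∀ u : EuclideanSpace ℝ (Fin w), ‖K u • u‖ ≤ C := fun u =>
    (hC' u).trans ((le_abs_self C').trans (le_add_of_nonneg_right zero_le_one))
  obtain ⟨ν₂, hν₂, hsq⟩ := hK.sq_second_moment
  set σ := ν₂ * g x with hσ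
  have hσ0 : 0 < σ := mul_pos hν₂ hsmooth.density_pos
  -- Makes `r * C` at most `1/5`, as the logarithmic expansion requires, and `2 * (r * C)` at most
  -- `η`.
  set r := min (1 / 5) (η / 2) / C with hr
  have hr0 : 0 < r := by positivity
  have hrC : r * C = min (1 / 5) (η / 2) := div_mul_cancel₀ _ hC0.ne'
  -- At `ε = 0` the inequality reads `0 < σ * r`, and it persists for small `ε` by continuity.
  obtain ⟨ε, hε0, hε⟩ : ∃ ε : ℝ, 0 < ε ∧ 4 * (w * ε) < (σ - w * (w * ε)) * r := by
    have hcont : Tendsto (fun ε : ℝ => (σ - w * (w * ε)) * r - 4 * (w * ε)) (𝓝[>] 0)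
        (𝓝 (σ * r)) := by
      have h1 : Continuous fun ε : ℝ => (σ - w * (w * ε)) * r - 4 * (w * ε) := by fun_prop
      simpa using (h1.tendsto 0).mono_left nhdsWithin_le_nhds
    obtain ⟨ε, hε1, hε2⟩ := ((hcont.eventually (lt_mem_nhds (mul_pos hσ0 hr0))).and
      self_mem_nhdsWithin).exists
    exact ⟨ε, hε2, by linarith⟩
  have hcoord : ∀ j : Fin w, Continuous fun u : EuclideanSpace ℝ (Fin w) => u j := fun j => by
    fun_prop
  have huniv : ContinuousAt (fun u => (κ u).real Set.univ) x := by
    simpa using continuousAt_const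
  have hmean : ∀ j : Fin w, WithHighProbability μ fun n ω =>
      |localAverage (fun u => u j * K u) Set.univ x (h n) (fun i : Fin n => X i ω)
        (fun i : Fin n => Y i ω) - 0| < ε := by
    intro j
    refine withHighProbability_of_tendstoInMeasure ?_ hε0
    have hcomp : HasCompactSupport fun u : EuclideanSpace ℝ (Fin w) => u j * K u :=
      hK.compactSupport.mul_left
    have hcont : Continuous fun u : EuclideanSpace ℝ (Fin w) => u j * K u :=
      (hcoord j).mul hK.continuous
    have h1 := tendstoInMeasure_localAverage_of_continuous hX hY hδ hmix hκ hg hsmooth hh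
      hcont hcomp MeasurableSet.univ huniv
    rwa [hK.integral_coord_mul j, zero_mul] at h1
  have hsecond : ∀ jk : Fin w × Fin w, WithHighProbability μ fun n ω =>
      |localAverage (fun u => u jk.1 * u jk.2 * K u ^ 2) Set.univ x (h n)
        (fun i : Fin n => X i ω) (fun i : Fin n => Y i ω)
        - if jk.1 = jk.2 then σ else 0| < ε := by
    intro jk
    refine withHighProbability_of_tendstoInMeasure ?_ hε0
    have hcomp : HasCompactSupport fun u : EuclideanSpace ℝ (Fin w) =>
        u jk.1 * u jk.2 * K u ^ 2 := by
      have hKK : HasCompactSupport fun u => K u ^ 2 := by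
        simp only [sq]
        exact hK.compactSupport.mul_left
      exact hKK.mul_left
    have hcont : Continuous fun u : EuclideanSpace ℝ (Fin w) => u jk.1 * u jk.2 * K u ^ 2 :=
      ((hcoord jk.1).mul (hcoord jk.2)).mul (hK.continuous.pow 2)
    have h1 := tendstoInMeasure_localAverage_of_continuous hX hY hδ hmix hκ hg hsmooth hh
      hcont hcomp MeasurableSet.univ huniv
    rw [hsq jk.1 jk.2] at h1
    simpa only [probReal_univ, one_mul, ite_mul, zero_mul] using h1
  refine ((WithHighProbability.all hmean).and (WithHighProbability.all hsecond)).mono ?_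
  filter_upwards [eventually_gt_atTop 0] with n hn ω hω i
  refine (abs_mul_adjustmentWeights_sub_one_le (Y := fun i : Fin n => Y i ω) hn (hh.pos n) hC hr0
    (hrC.trans_le (min_le_left _ _)) (fun j => by simpa using (hω.1 j).le)
    (fun j k => (hω.2 (j, k)).le) hε i).trans ?_
  rw [hrC]
  linarith [min_le_right (1 / 5 : ℝ) (η / 2)]

/-- Consistency of the estimated conditional distribution function at `b`, in one-sided form. -/
lemma withHighProbability_estCDF (hX : ∀ i, Measurable (X i))
    (hY : ∀ i, Measurable (Y i)) (hδ : 0 < δ)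
    (hmix : MixingAssumption (fun i ω => (X i ω, Y i ω)) μ δ)
    (hκ : HasCondDistrib (Y 0) (X 0) κ μ) (hg : IsDensity (μ.map (X 0)) g)
    (hsmooth : SmoothnessAssumption μ X κ g x) (hK : KernelAssumption K)
    (hh : BandwidthAssumption w δ h) {β : ℝ} (hβ : 0 < β) (b : ℝ) :
    (condCDF κ b x < β → WithHighProbability μ fun n ω =>
      estCDF K (h n) (fun i : Fin n => X i ω) (fun i : Fin n => Y i ω) x b < β) ∧
    (β < condCDF κ b x → WithHighProbability μ fun n ω =>
      β < estCDF K (h n) (fun i : Fin n => X i ω) (fun i : Fin n => Y i ω) x b) := by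
  have hg0 := hsmooth.density_pos
  have hlim : ∀ S : Set ℝ, MeasurableSet S → ContinuousAt (fun u => (κ u).real S) x →
      ∀ ε > 0, WithHighProbability μ fun n ω => |localAverage K S x (h n)
        (fun i : Fin n => X i ω) (fun i : Fin n => Y i ω) - (κ x).real S * g x| < ε := by
    intro S hS hκS ε hε
    refine withHighProbability_of_tendstoInMeasure ?_ hε
    have h1 := tendstoInMeasure_localAverage_of_continuous hX hY hδ hmix hκ hg hsmooth hh
      hK.continuous hK.compactSupport hS hκS
    rwa [hK.integral_eq_one, one_mul] at h1
  have huniv : ContinuousAt (fun u => (κ u).real Set.univ) x := by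
    simpa using continuousAt_const
  have hevent : ∀ ε > 0, WithHighProbability μ fun n ω =>
      (∀ i : Fin n, |n * adjustmentWeights K (h n) (fun i : Fin n => X i ω) x i - 1| ≤ ε) ∧
      |localAverage K (Set.Iic b) x (h n) (fun i : Fin n => X i ω) (fun i : Fin n => Y i ω)
        - condCDF κ b x * g x| < ε ∧
      |localAverage K Set.univ x (h n) (fun i : Fin n => X i ω) (fun i : Fin n => Y i ω)
        - g x| < ε := by
    intro ε hε
    refine (withHighProbability_adjustmentWeights hX hY hδ hmix hκ hg hsmooth hK hh hε).and
      ((hlim _ measurableSet_Iic (hsmooth.cdf_smooth b).continuousAt ε hε).and ?_)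
    simpa using hlim _ MeasurableSet.univ huniv ε hε
  set F := condCDF κ b x with hF
  have hsmall : ∀ f : ℝ → ℝ, Continuous f → 0 < f 0 → ∃ ε : ℝ, 0 < ε ∧ ε < 1 ∧ 0 < f ε := by
    intro f hf hf0
    obtain ⟨ε, ⟨h1, h2⟩, h3⟩ := ((((hf.tendsto 0).mono_left nhdsWithin_le_nhds).eventually
      (lt_mem_nhds hf0)).and ((gt_mem_nhds one_pos).filter_mono nhdsWithin_le_nhds)
      |>.and (self_mem_nhdsWithin (s := Set.Ioi (0 : ℝ)))).exists
    exact ⟨ε, h3, h2, h1⟩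
  constructor
  · intro hlt
    -- At `ε = 0` the function below equals `g x * (β - F) > 0`; its positivity at some `ε < 1`
    -- leaves room for the errors in the weights and in both averages.
    obtain ⟨ε, hε0, hε1, hε⟩ := hsmall
      (fun ε => β * ((1 - ε) * (g x - ε)) - (1 + ε) * (F * g x + ε)) (by fun_prop)
      (by nlinarith)
    refine (hevent ε hε0).mono ?_
    filter_upwards [eventually_gt_atTop 0] with n hn ω ⟨h1, h2, h3⟩
    refine estCDF_lt hK.nonneg (hh.pos n) hn hβ h1 ?_
    have h4 := mul_lt_mul_of_pos_left (sub_lt_iff_lt_add'.1 (abs_lt.1 h2).2)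
      (by linarith : 0 < 1 + ε)
    have h5 := mul_lt_mul_of_pos_left (mul_lt_mul_of_pos_left
      (neg_lt_sub_iff_lt_add.1 (abs_lt.1 h3).1) (by linarith : 0 < 1 - ε)) hβ
    nlinarith
  · intro hlt
    obtain ⟨ε, hε0, hε1, hε⟩ := hsmall
      (fun ε => (1 - ε) * (F * g x - ε) - β * ((1 + ε) * (g x + ε))) (by fun_prop)
      (by nlinarith)
    refine (hevent ε hε0).mono ?_
    filter_upwards [eventually_gt_atTop 0] with n hn ω ⟨h1, h2, h3⟩
    refine lt_estCDF hK.nonneg (hh.pos n) hn hβ h1 ?_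
    have h4 : (1 - ε) * (F * g x - ε) < (1 - ε) * localAverage K (Set.Iic b) x (h n)
        (fun i : Fin n => X i ω) (fun i : Fin n => Y i ω) :=
      mul_lt_mul_of_pos_left (by linarith [(abs_lt.1 h2).1]) (by linarith)
    have h5 : β * ((1 + ε) * localAverage K Set.univ x (h n)
        (fun i : Fin n => X i ω) (fun i : Fin n => Y i ω)) < β * ((1 + ε) * (g x + ε)) :=
      mul_lt_mul_of_pos_left (mul_lt_mul_of_pos_left (by linarith [(abs_lt.1 h3).2])
        (by linarith)) hβ
    linarith

end Consistency

end RNW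

theorem mainTheorem4
    {Ω : Type*} [MeasurableSpace Ω] (μ : Measure Ω) [IsProbabilityMeasure μ]
    (w : ℕ) (hw : 1 ≤ w)
    -- the data: `n` observations are `(X i, Y i)`, `i = 0, …, n - 1`
    (X : ℕ → Ω → EuclideanSpace ℝ (Fin w)) (Y : ℕ → Ω → ℝ)
    (hX : ∀ i, Measurable (X i)) (hY : ∀ i, Measurable (Y i))
    (δ : ℝ) (hδ : 0 < δ)
    (hmix : RNW.MixingAssumption (fun i ω => (X i ω, Y i ω)) μ δ)
    -- the conditional law of `Y i` given `X i`, and the density of `X i`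
    (κ : Kernel (EuclideanSpace ℝ (Fin w)) ℝ) [IsMarkovKernel κ]
    (hκ : HasCondDistrib (Y 0) (X 0) κ μ)
    (g : EuclideanSpace ℝ (Fin w) → ℝ) (hg : RNW.IsDensity (μ.map (X 0)) g)
    (x : EuclideanSpace ℝ (Fin w))
    (hsmooth : RNW.SmoothnessAssumption μ X κ g x)
    (K : EuclideanSpace ℝ (Fin w) → ℝ) (hK : RNW.KernelAssumption K)
    (h : ℕ → ℝ) (hh : RNW.BandwidthAssumption w δ h)
    (β : ℝ) (hβ : β ∈ Set.Ioo (0 : ℝ) 1)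
    -- uniqueness of the conditional `β`-quantile at `x`
    (huniq : ∀ y : ℝ, RNW.quantile (fun b => RNW.condCDF κ b x) β < y → β < RNW.condCDF κ y x) :
    TendstoInMeasure μ
      (fun (n : ℕ) (ω : Ω) =>
        RNW.estQuantile K (h n) (fun i : Fin n => X i ω) (fun i : Fin n => Y i ω) x β)
      atTop
      (fun _ => RNW.quantile (fun b => RNW.condCDF κ b x) β) := by
  set Q := RNW.quantile (fun b => RNW.condCDF κ b x) β with hQ
  refine RNW.tendstoInMeasure_of_withHighProbability fun ε hε => ?_
  have hlo := (RNW.withHighProbability_estCDF hX hY hδ hmix hκ hg hsmooth hK hh hβ.1 (Q - ε)).1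
    (RNW.condCDF_lt_of_lt_quantile κ x hβ.1 (by linarith))
  -- Uniqueness of the quantile enters here: it makes the inequality at `Q + ε` strict, so that it
  -- survives estimation error.
  have hhi := (RNW.withHighProbability_estCDF hX hY hδ hmix hκ hg hsmooth hK hh hβ.1 (Q + ε)).2
    (huniq _ (by linarith))
  refine (hlo.and hhi).mono (Eventually.of_forall fun n ω hω => ?_)
  exact RNW.abs_quantile_sub_le (RNW.estCDF_mono hK.nonneg (hh.pos n)) hω.1 hω.2.le
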